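/- Consider the binary symmetric compound multiple access channel with a relay. All alphabets are $\{0,1\}$, $\oplus$ is addition modulo 2, and at each time $$Y_1=X_1\oplus X_3\oplus Z_1,\qquad Y_2=X_2\oplus X_3\oplus Z_2,\qquad Y_3=X_1\oplus X_2\oplus Z_3,$$ where $Z_i$ is Bernoulli with $\Pr[Z_i=1]=\varepsilon_i\in[0,1]$, and the noise variables are independent of each other, over time, and of the messages. Transmitters 1 and 2 send $X_1^n$ and $X_2^n$, which are functions of independent messages $W_1$ and $W_2$, uniform on $\{1,\dots,\lfloor 2^{nR_1}\rfloor\}$ and $\{1,\dots,\lfloor 2^{nR_2}\rfloor\}$. The relay has no message of its own ($R_3=0$), and its input $X_{3,j}$ is a function of its past outputs $Y_{3,1},\dots,Y_{3,j-1}$. Receiver $i$ ($i=1,2$) estimates both messages from $Y_i^n$. A pair $(R_1,R_2)$ with $R_1,R_2\ge 0$ is achievable if there are codes of every length $n$ for which the probability that at least one receiver errs, averaged over the messages, tends to $0$ as $n\to\infty$; the capacity region is the closure of the set of achievable pairs. **Proposition.** The capacity region is the set of all pairs $(R_1,R_2)$ with $R_1,R_2\ge 0$ and $$R_1\le 1-H_b(\varepsilon_3),\qquad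 R_2\le 1-H_b(\varepsilon_3),\qquad R_1+R_2\le\min\{1-H_b(\varepsilon_1),\,1-H_b(\varepsilon_2)\},$$ where $H_b(\varepsilon)=-\varepsilon\log_2\varepsilon-(1-\varepsilon)\log_2(1-\varepsilon)$, with $0\log_2 0=0$. Moreover, it is achieved by binary linear block codes with a relay that decodes only the modulo-2 sum of the messages: the capacity region is also the closure of the set of pairs $(R_1,R_2)$, $R_1,R_2\ge0$, that are achieved by schemes of the following form. For some $m\ge 0$ that does not depend on $n$, there are $m+1$ blocks of $n$ channel uses. In block $b=1,\dots,m$ transmitter $j$ sends a new uniform message vector $u_{j,b}\in\mathbb F_2^{k_j}$, where $m k_j\ge (m+1)nR_j$, as the codeword $[\,0\;\,u_{j,b}]\,G$; here $[\,0\;\,u]$ is $u$ padded with zeros to length $k=\max\{k_1,k_2\}$, and $G\in\mathbb F_2^{k\times n}$ is a generator matrix common to both transmitters. In block $m+1$ the transmitters send zeros. From its outputs in block $b$ alone, the relay forms one estimate $\hat u_{3,b}\in\mathbb F_2^{k}$ of $[\,0\;\,u_{1,b}]\oplus[\,0\;\,u_{2,b}]$; it sends $\hat u_{3,b}G_3$,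 with a second generator matrix $G_3\in\mathbb F_2^{k\times n}$, in block $b+1$, and it sends zeros in block $1$. As $n\to\infty$, both the probability that some receiver errs and the probability that the relay errs about the sum in some block $b\le m$ tend to $0$. -/

import Mathlib

open Filter Topology
open scoped Matrix

namespace CMACr

/-- A discrete memoryless compound multiple access channel with a relay, given by its
transition probabilities `p(y₁,y₂,y₃ | x₁,x₂,x₃)`. -/
structure Channel (X₁ X₂ X₃ Y₁ Y₂ Y₃ : Type) [Fintype Y₁] [Fintype Y₂] [Fintype Y₃] where
  prob : X₁ → X₂ → X₃ → Y₁ × Y₂ × Y₃ → ℝ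
  nonneg : ∀ x₁ x₂ x₃ y, 0 ≤ prob x₁ x₂ x₃ y
  sum_eq_one : ∀ x₁ x₂ x₃, ∑ y, prob x₁ x₂ x₃ y = 1

/-- A code of block length `n` with message sets `W₁`, `W₂` (transmitters) and `W₃` (relay):
two block encoders, a causal relay (at the time with zero-based index `j` it has seen the
first `j` symbols of its output), and two decoders, each of which estimates all messages. -/
structure Code (X₁ X₂ X₃ Y₁ Y₂ Y₃ W₁ W₂ W₃ : Type) (n : ℕ) where
  f₁ : W₁ → Fin n → X₁
  f₂ : W₂ → Fin n → X₂
  g : (j : Fin n) → W₃ → (Fin (j : ℕ) → Y₃) → X₃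
  h₁ : (Fin n → Y₁) → W₁ × W₂ × W₃
  h₂ : (Fin n → Y₂) → W₁ × W₂ × W₃

section Model

variable {X₁ X₂ X₃ Y₁ Y₂ Y₃ W₁ W₂ W₃ : Type} [Fintype Y₁] [Fintype Y₂] [Fintype Y₃]
  [Fintype W₁] [Fintype W₂] [Fintype W₃] {n : ℕ}

/-- The conditional probability of the output blocks `(y₁ⁿ, y₂ⁿ, y₃ⁿ)` given the messages. -/
noncomputable def outputLaw (ch : Channel X₁ X₂ X₃ Y₁ Y₂ Y₃)
    (c : Code X₁ X₂ X₃ Y₁ Y₂ Y₃ W₁ W₂ W₃ n) (w : W₁ × W₂ × W₃)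
    (y : (Fin n → Y₁) × (Fin n → Y₂) × (Fin n → Y₃)) : ℝ :=
  ∏ j : Fin n,
    ch.prob (c.f₁ w.1 j) (c.f₂ w.2.1 j)
      (c.g j w.2.2 (fun i => y.2.2 (Fin.castLE j.isLt.le i)))
      (y.1 j, y.2.1 j, y.2.2 j)

/-- The average, over uniformly distributed messages, of the conditional probability
that the output blocks lie in the event `E w`. -/
noncomputable def avgProb (ch : Channel X₁ X₂ X₃ Y₁ Y₂ Y₃)
    (c : Code X₁ X₂ X₃ Y₁ Y₂ Y₃ W₁ W₂ W₃ n)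
    (E : W₁ × W₂ × W₃ → Set ((Fin n → Y₁) × (Fin n → Y₂) × (Fin n → Y₃))) : ℝ :=
  (1 / (Fintype.card (W₁ × W₂ × W₃) : ℝ)) *
    ∑ w, ∑ y, (E w).indicator (outputLaw ch c w) y

/-- The average probability of block error: at least one of the two receivers errs. -/
noncomputable def errorProb (ch : Channel X₁ X₂ X₃ Y₁ Y₂ Y₃)
    (c : Code X₁ X₂ X₃ Y₁ Y₂ Y₃ W₁ W₂ W₃ n) : ℝ :=
  avgProb ch c (fun w => {y | c.h₁ y.1 ≠ w ∨ c.h₂ y.2.1 ≠ w})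

/-- Achievability of a rate triplet; the message sets are `{1, …, ⌊2 ^ (n R)⌋}`. -/
def Achievable (ch : Channel X₁ X₂ X₃ Y₁ Y₂ Y₃) (R₁ R₂ R₃ : ℝ) : Prop :=
  0 ≤ R₁ ∧ 0 ≤ R₂ ∧ 0 ≤ R₃ ∧
    ∃ c : (n : ℕ) → Code X₁ X₂ X₃ Y₁ Y₂ Y₃
        (Fin ⌊(2 : ℝ) ^ ((n : ℝ) * R₁)⌋₊) (Fin ⌊(2 : ℝ) ^ ((n : ℝ) * R₂)⌋₊)
        (Fin ⌊(2 : ℝ) ^ ((n : ℝ) * R₃)⌋₊) n,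
      Tendsto (fun n => errorProb ch (c n)) atTop (𝓝 0)

/-- The capacity region when the relay has no message of its own (`R₃ = 0`). -/
def capacityRegion (ch : Channel X₁ X₂ X₃ Y₁ Y₂ Y₃) : Set (ℝ × ℝ) :=
  closure {R | Achievable ch R.1 R.2 0}

end Model

/-- The Bernoulli probability mass function on `{0, 1}`, with mass `ε` at `1`. -/
def bern (ε : ℝ) (z : ZMod 2) : ℝ := if z = 1 then ε else 1 - ε

theorem bern_nonneg {ε : ℝ} (h : ε ∈ Set.Icc (0 : ℝ) 1) (z : ZMod 2) : 0 ≤ bern ε z := by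
  unfold bern
  split_ifs
  · exact h.1
  · linarith [h.2]

theorem bern_sum (ε : ℝ) : ∑ z, bern ε z = 1 := by
  have hu : (Finset.univ : Finset (ZMod 2)) = {0, 1} := by decide
  rw [hu, Finset.sum_pair (by decide)]
  simp [bern]

/-- The binary symmetric channel `Y₁ = X₁ ⊕ X₃ ⊕ Z₁`, `Y₂ = X₂ ⊕ X₃ ⊕ Z₂`,
`Y₃ = X₁ ⊕ X₂ ⊕ Z₃` with independent noises `Zᵢ ∼ Bernoulli(εᵢ)`: the law of the output
is the image of the law of the noise. -/
noncomputable def bsChannel (ε₁ ε₂ ε₃ : ℝ) (h₁ : ε₁ ∈ Set.Icc (0 : ℝ) 1)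
    (h₂ : ε₂ ∈ Set.Icc (0 : ℝ) 1) (h₃ : ε₃ ∈ Set.Icc (0 : ℝ) 1) :
    Channel (ZMod 2) (ZMod 2) (ZMod 2) (ZMod 2) (ZMod 2) (ZMod 2) where
  prob x₁ x₂ x₃ y :=
    ∑ z₁ : ZMod 2, ∑ z₂ : ZMod 2, ∑ z₃ : ZMod 2,
      if y = (x₁ + x₃ + z₁, x₂ + x₃ + z₂, x₁ + x₂ + z₃) then
        bern ε₁ z₁ * bern ε₂ z₂ * bern ε₃ z₃ else 0
  nonneg x₁ x₂ x₃ y := by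
    refine Finset.sum_nonneg fun z₁ _ => Finset.sum_nonneg fun z₂ _ =>
      Finset.sum_nonneg fun z₃ _ => ?_
    split_ifs
    · exact mul_nonneg (mul_nonneg (bern_nonneg h₁ _) (bern_nonneg h₂ _)) (bern_nonneg h₃ _)
    · exact le_rfl
  sum_eq_one x₁ x₂ x₃ := by
    rw [Finset.sum_comm]
    simp_rw [Finset.sum_comm (s := (Finset.univ : Finset (ZMod 2 × ZMod 2 × ZMod 2)))]
    simp only [Finset.sum_ite_eq', Finset.mem_univ, if_true]
    simp_rw [← Finset.mul_sum, bern_sum, mul_one, ← Finset.mul_sum, bern_sum, mul_one, bern_sum]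

/-- The binary entropy function, in bits. -/
noncomputable def Hb (ε : ℝ) : ℝ :=
  -ε * Real.logb 2 ε - (1 - ε) * Real.logb 2 (1 - ε)

/-- Zero padding on the left: `u ↦ [0 u]`, from length `l` to length `k ≥ l`. -/
def pad {l : ℕ} (k : ℕ) (u : Fin l → ZMod 2) (i : Fin k) : ZMod 2 :=
  if h : k - l ≤ (i : ℕ) then u ⟨i - (k - l), by omega⟩ else 0

/-- A block-Markov scheme with binary linear block codes. There are `m + 1` blocks of `n`
channel uses; in each of the first `m` blocks transmitter `j` sends `kⱼ` new bits, and both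
transmitters use the same linear code, with generator matrix `G`. From its output in a block
the relay forms, by means of `dec`, one vector of `max k₁ k₂` bits (its estimate of the sum
of the two padded message vectors of that block), and it sends this vector in the next block,
encoded with a linear code with generator matrix `G₃`. -/
structure LinearScheme (m n k₁ k₂ : ℕ) where
  G : Matrix (Fin (max k₁ k₂)) (Fin n) (ZMod 2)
  G₃ : Matrix (Fin (max k₁ k₂)) (Fin n) (ZMod 2)
  dec : (Fin n → ZMod 2) → (Fin (max k₁ k₂) → ZMod 2)
  h₁ : (Fin ((m + 1) * n) → ZMod 2) →
    (Fin m → Fin k₁ → ZMod 2) × (Fin m → Fin k₂ → ZMod 2)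
  h₂ : (Fin ((m + 1) * n) → ZMod 2) →
    (Fin m → Fin k₁ → ZMod 2) × (Fin m → Fin k₂ → ZMod 2)

/-- The transmitted sequence for the message vectors `u 0, …, u (m - 1)`: the codeword of
`[0 (u b)]` in block `b < m`, and zeros in the last block. -/
def encodeBlocks {m n k l : ℕ} (G : Matrix (Fin k) (Fin n) (ZMod 2))
    (u : Fin m → Fin l → ZMod 2) (t : Fin ((m + 1) * n)) : ZMod 2 :=
  if h : (t.divNat : ℕ) < m then (pad k (u ⟨t.divNat, h⟩) ᵥ* G) t.modNat else 0

/-- The scheme as a code of length `(m + 1) n`. In block `0` the relay sends zeros, in block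
`b ≥ 1` the codeword of the vector that it formed from its outputs in block `b - 1`, i.e. at
the times `(b - 1) n, …, (b - 1) n + n - 1`. -/
def LinearScheme.toCode {m n k₁ k₂ : ℕ} (s : LinearScheme m n k₁ k₂) :
    Code (ZMod 2) (ZMod 2) (ZMod 2) (ZMod 2) (ZMod 2) (ZMod 2)
      (Fin m → Fin k₁ → ZMod 2) (Fin m → Fin k₂ → ZMod 2) Unit ((m + 1) * n) where
  f₁ u := encodeBlocks s.G u
  f₂ u := encodeBlocks s.G u
  g t _ y :=
    if h : 1 ≤ (t.divNat : ℕ) then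
      (s.dec (fun i => y ⟨((t.divNat : ℕ) - 1) * n + i, by
          have h1 : (t : ℕ) / n * n ≤ t := Nat.div_mul_le_self _ _
          have h2 : (t.divNat : ℕ) = (t : ℕ) / n := rfl
          have h3 : ((t : ℕ) / n - 1) * n + n = (t : ℕ) / n * n := by
            rw [h2] at h
            rw [← Nat.succ_mul, Nat.succ_eq_add_one, Nat.sub_add_cancel h]
          have h4 := i.isLt
          rw [h2]
          omega⟩) ᵥ* s.G₃) t.modNat
    else 0
  h₁ y := ((s.h₁ y).1, (s.h₁ y).2, ())
  h₂ y := ((s.h₂ y).1, (s.h₂ y).2, ())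

/-- The average probability that in some block `b < m` the vector formed by the relay from
its outputs in that block is not the modulo-2 sum of the padded message vectors. -/
noncomputable def LinearScheme.relayErrorProb {m n k₁ k₂ : ℕ} (s : LinearScheme m n k₁ k₂)
    (ch : Channel (ZMod 2) (ZMod 2) (ZMod 2) (ZMod 2) (ZMod 2) (ZMod 2)) : ℝ :=
  avgProb ch s.toCode (fun w =>
    {y | ∃ b : Fin m,
      s.dec (fun i => y.2.2 (finProdFinEquiv (b.castSucc, i))) ≠
        pad (max k₁ k₂) (w.1 b) + pad (max k₁ k₂) (w.2.1 b)})

/-- Achievability of a rate pair by binary linear block codes with a relay that decodes the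
modulo-2 sum of the messages: for a fixed number of blocks, there are schemes with block
length `n → ∞` that send at least `(m + 1) n Rⱼ` message bits of transmitter `j` in
`(m + 1) n` channel uses, such that the block error probability at the receivers and the
probability that the relay errs about the sum tend to zero. -/
def LinearAchievable (ch : Channel (ZMod 2) (ZMod 2) (ZMod 2) (ZMod 2) (ZMod 2) (ZMod 2))
    (R₁ R₂ : ℝ) : Prop :=
  0 ≤ R₁ ∧ 0 ≤ R₂ ∧
    ∃ (m : ℕ) (k₁ k₂ : ℕ → ℕ) (s : (n : ℕ) → LinearScheme m n (k₁ n) (k₂ n)),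
      (∀ n : ℕ, ((m : ℝ) + 1) * n * R₁ ≤ (m : ℝ) * k₁ n) ∧
      (∀ n : ℕ, ((m : ℝ) + 1) * n * R₂ ≤ (m : ℝ) * k₂ n) ∧
      Tendsto (fun n => errorProb ch (s n).toCode) atTop (𝓝 0) ∧
      Tendsto (fun n => (s n).relayErrorProb ch) atTop (𝓝 0)

end CMACr

namespace CMACr

/-! For fixed messages the noise blocks and the output blocks determine each other, so every
probability is that of an event in the noise alone (`weight_outputLaw`).

Converse: freezing two of the three noise blocks leaves a single binary symmetric channel. With
`z₂`, `z₃` frozen, the relay input is a function of the messages, and receiver 1 decodes all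
messages from a codeword plus `z₁`; this bounds the sum rate, and receiver 2 is symmetric. Moreover,
receiver 1 hears `w₂` only through the relay, so with everything but `w₂` and `z₃` frozen it decodes
`w₂` from the relay's output; receiver 2 does the same for `w₁`. Each of these channels is bounded
by counting (`sum_weight_decode_le`): noise vectors of probability well above `2 ^ (-n * Hb ε)` are
rare, and each output sequence is decoded to only one message. Above capacity the success
probability would then tend to zero (`rate_le_of_successBound`).

Direct part: since the transmitters share a linear code, the relay sees a noisy codeword of the sum,
with `max k₁ k₂` unknown bits. A receiver that already knows the previous message of its own
transmitter faces two unknowns in a block: the new message of that transmitter, encoded by `G`, and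
the previous message of the other one, encoded by `G₃`; together `k₁ + k₂` bits. Under random
matrices a nonzero combination of these is uniform, so a union bound over typical noise yields one
pair of matrices that is good for the relay and both receivers (`exists_matrices`). Outside a rare
set of noise blocks, independent of the messages, decoding is then correct (`eq_of_signal`,
`linearScheme_correct`). The loss `(m + 1) / m` vanishes for large `m`, and scaling towards the
origin reaches the boundary (`rateRegion_subset_closure`). -/

/-- The total weight of the set `S` under the weight function `p` on a finite type. -/
noncomputable def weight {α : Type*} [Fintype α] (p : α → ℝ) (S : Set α) : ℝ :=
  ∑ a, S.indicator p a

/-! ### Finite weights and union bounds -/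

section Weight

variable {α β : Type*} [Fintype α] [Fintype β] {p : α → ℝ}

theorem weight_nonneg (hp : ∀ a, 0 ≤ p a) (S : Set α) : 0 ≤ weight p S :=
  Finset.sum_nonneg fun _ _ => Set.indicator_nonneg (fun a _ => hp a) _

theorem weight_mono (hp : ∀ a, 0 ≤ p a) {S T : Set α} (h : S ⊆ T) : weight p S ≤ weight p T :=
  Finset.sum_le_sum fun a _ => Set.indicator_le_indicator_of_subset h hp a

theorem weight_add_compl (S : Set α) : weight p S + weight p Sᶜ = ∑ a, p a := by
  rw [weight, weight, ← Finset.sum_add_distrib]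
  exact Finset.sum_congr rfl fun a _ => Set.indicator_self_add_compl_apply S p a

theorem weight_union_le (hp : ∀ a, 0 ≤ p a) (S T : Set α) :
    weight p (S ∪ T) ≤ weight p S + weight p T := by
  rw [weight, weight, weight, ← Finset.sum_add_distrib]
  refine Finset.sum_le_sum fun a _ => ?_
  have := hp a
  by_cases h1 : a ∈ S <;> by_cases h2 : a ∈ T <;> simp [h1, h2, this]

theorem weight_iUnion_le {ι : Type*} [Fintype ι] (hp : ∀ a, 0 ≤ p a) (S : ι → Set α) :
    weight p (⋃ i, S i) ≤ ∑ i, weight p (S i) := by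
  simp only [weight]
  rw [Finset.sum_comm]
  refine Finset.sum_le_sum fun a _ => ?_
  have h0 : ∀ i ∈ Finset.univ, 0 ≤ (S i).indicator p a :=
    fun i _ => Set.indicator_nonneg (fun a _ => hp a) _
  by_cases h : a ∈ ⋃ i, S i
  · obtain ⟨i, hi⟩ := Set.mem_iUnion.1 h
    rw [Set.indicator_of_mem h, ← Set.indicator_of_mem hi p]
    exact Finset.single_le_sum h0 (Finset.mem_univ i)
  · rw [Set.indicator_of_notMem h]
    exact Finset.sum_nonneg h0

theorem weight_equiv (e : β ≃ α) {q : β → ℝ} (h : ∀ b, q b = p (e b)) (S : Set α) :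
    weight q (e ⁻¹' S) = weight p S := by
  refine Fintype.sum_equiv e _ _ fun b => ?_
  by_cases hb : e b ∈ S
  · rw [Set.indicator_of_mem hb, Set.indicator_of_mem (by exact hb), h]
  · rw [Set.indicator_of_notMem hb, Set.indicator_of_notMem (by exact hb)]

end Weight

/-! ### Bernoulli noise vectors and their marginals -/

/-- The law of a vector of independent Bernoulli variables. -/
noncomputable def noiseLaw (ε : ℝ) {ι : Type*} [Fintype ι] (z : ι → ZMod 2) : ℝ :=
  ∏ j, bern ε (z j)

section NoiseLaw

variable {ι κ : Type*} [Fintype ι] [Fintype κ] {ε : ℝ}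

theorem noiseLaw_nonneg (h : ε ∈ Set.Icc (0 : ℝ) 1) (z : ι → ZMod 2) : 0 ≤ noiseLaw ε z :=
  Finset.prod_nonneg fun _ _ => bern_nonneg h _

theorem noiseLaw_sum [DecidableEq ι] : ∑ z : ι → ZMod 2, noiseLaw ε z = 1 := by
  have h := Finset.prod_univ_sum (fun _ : ι => (Finset.univ : Finset (ZMod 2)))
    (fun _ a => bern ε a)
  simp only [bern_sum, Finset.prod_const_one, Fintype.piFinset_univ] at h
  exact h.symm

/-- The marginal law along an injective map of index sets. -/
theorem noiseLaw_fiber_sum [DecidableEq κ] {e : ι → κ} (he : Function.Injective e)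
    (x : ι → ZMod 2) :
    ∑ z : κ → ZMod 2 with z ∘ e = x, noiseLaw ε z = noiseLaw ε x := by
  classical
  let t : κ → Finset (ZMod 2) := fun j =>
    Finset.univ.filter fun a => ∀ i, e i = j → x i = a
  have ht : (Finset.univ.filter fun z : κ → ZMod 2 => z ∘ e = x) = Fintype.piFinset t := by
    ext z
    simp only [Finset.mem_filter, Finset.mem_univ, true_and, Fintype.mem_piFinset, t]
    constructor
    · rintro rfl j i rfl
      rfl
    · exact fun h => funext fun i => (h (e i) i rfl).symm
  have h := Finset.prod_univ_sum t (fun _ a => bern ε a)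
  rw [ht]
  refine h.symm.trans ?_
  have h1 : ∀ j, j ∉ Finset.univ.image e → ∑ a ∈ t j, bern ε a = 1 := fun j hj => by
    have : t j = Finset.univ := by
      ext a
      simp only [Finset.mem_filter, Finset.mem_univ, true_and, t, iff_true]
      intro i hi
      exact absurd (Finset.mem_image.2 ⟨i, Finset.mem_univ _, hi⟩) hj
    rw [this, bern_sum]
  rw [← Finset.prod_subset (Finset.subset_univ (Finset.univ.image e)) fun j _ hj => h1 j hj,
    Finset.prod_image fun a _ b _ hab => he hab]
  refine Finset.prod_congr rfl fun i _ => ?_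
  have : t (e i) = {x i} := by
    ext a
    simp only [Finset.mem_filter, Finset.mem_univ, true_and, t, Finset.mem_singleton]
    exact ⟨fun h => (h i rfl).symm, fun h k hk => by rw [he hk, h]⟩
  rw [this, Finset.sum_singleton]

theorem sum_noiseLaw_mul_comp [DecidableEq ι] [DecidableEq κ] {e : ι → κ}
    (he : Function.Injective e) (F : (ι → ZMod 2) → ℝ) :
    ∑ z : κ → ZMod 2, noiseLaw ε z * F (z ∘ e) = ∑ x, noiseLaw ε x * F x := by
  rw [← Finset.sum_fiberwise_of_maps_to (t := Finset.univ) (g := fun z : κ → ZMod 2 => z ∘ e)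
    (fun _ _ => Finset.mem_univ _)]
  refine Finset.sum_congr rfl fun x _ => ?_
  rw [← noiseLaw_fiber_sum he x, Finset.sum_mul]
  exact Finset.sum_congr rfl fun z hz => by rw [(Finset.mem_filter.1 hz).2]

theorem weight_eq_sum_mul {α : Type*} [Fintype α] (p : α → ℝ) (S : Set α) :
    weight p S = ∑ a, p a * S.indicator 1 a :=
  Finset.sum_congr rfl fun a _ => by by_cases h : a ∈ S <;> simp [h]

theorem weight_noiseLaw_comp [DecidableEq ι] [DecidableEq κ] {e : ι → κ}
    (he : Function.Injective e) (S : Set (ι → ZMod 2)) :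
    weight (noiseLaw ε) {z : κ → ZMod 2 | z ∘ e ∈ S} = weight (noiseLaw ε) S := by
  rw [weight_eq_sum_mul, weight_eq_sum_mul, ← sum_noiseLaw_mul_comp he]
  rfl

end NoiseLaw

/-! ### Self-information and typical noise -/

/-- The self-information of a Bernoulli symbol, in bits. -/
noncomputable def info (ε : ℝ) (z : ZMod 2) : ℝ := -Real.logb 2 (bern ε z)

theorem sum_bern_mul (ε : ℝ) (f : ZMod 2 → ℝ) :
    ∑ z, bern ε z * f z = (1 - ε) * f 0 + ε * f 1 := by
  have hu : (Finset.univ : Finset (ZMod 2)) = {0, 1} := by decide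
  rw [hu, Finset.sum_pair (by decide)]
  simp [bern]

theorem sum_bern_mul_info_sub (ε : ℝ) : ∑ z, bern ε z * (info ε z - Hb ε) = 0 := by
  rw [sum_bern_mul]
  simp only [info, bern, Hb, zero_ne_one, if_false, if_true]
  ring

theorem sum_noiseLaw_succ (ε : ℝ) {n : ℕ} (F : (Fin (n + 1) → ZMod 2) → ℝ) :
    ∑ z, noiseLaw ε z * F z =
      ∑ a, bern ε a * ∑ z : Fin n → ZMod 2, noiseLaw ε z * F (Fin.cons a z) := by
  rw [← (Fin.consEquiv fun _ : Fin (n + 1) => ZMod 2).sum_comp, Fintype.sum_prod_type]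
  refine Finset.sum_congr rfl fun a _ => ?_
  rw [Finset.mul_sum]
  refine Finset.sum_congr rfl fun z _ => ?_
  have h : (Fin.consEquiv fun _ : Fin (n + 1) => ZMod 2) (a, z) = Fin.cons a z := rfl
  simp only [h, noiseLaw, Fin.prod_univ_succ, Fin.cons_zero, Fin.cons_succ]
  ring

theorem sum_noiseLaw_mul_sum (ε : ℝ) {a : ZMod 2 → ℝ} (ha : ∑ z, bern ε z * a z = 0) (n : ℕ) :
    ∑ z : Fin n → ZMod 2, noiseLaw ε z * ∑ i, a (z i) = 0 := by
  induction n with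
  | zero => simp
  | succ n ih =>
    rw [sum_noiseLaw_succ]
    simp only [Fin.sum_univ_succ, Fin.cons_zero, Fin.cons_succ, mul_add, Finset.sum_add_distrib,
      ih, ← Finset.sum_mul, noiseLaw_sum, one_mul, add_zero, ha]

/-- The second moment of a sum of independent centred variables. -/
theorem sum_noiseLaw_mul_sum_sq (ε : ℝ) {a : ZMod 2 → ℝ} (ha : ∑ z, bern ε z * a z = 0)
    (n : ℕ) :
    ∑ z : Fin n → ZMod 2, noiseLaw ε z * (∑ i, a (z i)) ^ 2 = n * ∑ z, bern ε z * a z ^ 2 := by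
  induction n with
  | zero => simp
  | succ n ih =>
    rw [sum_noiseLaw_succ]
    have h : ∀ b, ∑ z : Fin n → ZMod 2,
        noiseLaw ε z * (∑ i, a ((Fin.cons b z : Fin (n + 1) → ZMod 2) i)) ^ 2 =
          a b ^ 2 + n * ∑ z, bern ε z * a z ^ 2 := fun b => by
      rw [← ih]
      have h2 : ∀ z : Fin n → ZMod 2,
          noiseLaw ε z * (∑ i, a ((Fin.cons b z : Fin (n + 1) → ZMod 2) i)) ^ 2 =
            noiseLaw ε z * a b ^ 2 + 2 * a b * (noiseLaw ε z * ∑ i, a (z i)) +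
              noiseLaw ε z * (∑ i, a (z i)) ^ 2 := fun z => by
        simp only [Fin.sum_univ_succ, Fin.cons_zero, Fin.cons_succ]
        ring
      simp only [h2, Finset.sum_add_distrib, ← Finset.sum_mul, ← Finset.mul_sum, noiseLaw_sum,
        sum_noiseLaw_mul_sum ε ha]
      ring
    simp only [h, mul_add, Finset.sum_add_distrib, ← Finset.sum_mul, bern_sum]
    push_cast
    ring

/-- The variance of the self-information. -/
noncomputable def infoVar (ε : ℝ) : ℝ := ∑ z, bern ε z * (info ε z - Hb ε) ^ 2

/-- Chebyshev's inequality: the second moment of the sum is `n * infoVar ε`, and one factor `n`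
cancels, so deviations of order `n` have probability `O(1 / n)`. -/
theorem weight_info_deviation_le {ε : ℝ} (h : ε ∈ Set.Icc (0 : ℝ) 1) {δ : ℝ} (hδ : 0 < δ)
    (n : ℕ) :
    n * δ ^ 2 * weight (noiseLaw ε)
      {z : Fin n → ZMod 2 | n * δ ≤ |∑ i, (info ε (z i) - Hb ε)|} ≤ infoVar ε := by
  rcases Nat.eq_zero_or_pos n with rfl | hn
  · simp only [Nat.cast_zero, zero_mul]
    exact Finset.sum_nonneg fun z _ => mul_nonneg (bern_nonneg h z) (sq_nonneg _)
  have hn' : (0 : ℝ) < n := by exact_mod_cast hn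
  have key := sum_noiseLaw_mul_sum_sq ε (sum_bern_mul_info_sub ε) n
  have h1 : (n * δ) ^ 2 * weight (noiseLaw ε)
      {z : Fin n → ZMod 2 | n * δ ≤ |∑ i, (info ε (z i) - Hb ε)|} ≤ n * infoVar ε := by
    rw [infoVar, ← key, weight, Finset.mul_sum]
    refine Finset.sum_le_sum fun z _ => ?_
    have h0 := noiseLaw_nonneg h z
    by_cases hz : n * δ ≤ |∑ i, (info ε (z i) - Hb ε)|
    · rw [Set.indicator_of_mem (by exact hz), mul_comm]
      refine mul_le_mul_of_nonneg_left ?_ h0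
      rw [← sq_abs (∑ i, (info ε (z i) - Hb ε))]
      exact pow_le_pow_left₀ (by positivity) hz 2
    · rw [Set.indicator_of_notMem (by exact hz), mul_zero]
      positivity
  have h2 : n * (n * δ ^ 2 * weight (noiseLaw ε)
      {z : Fin n → ZMod 2 | n * δ ≤ |∑ i, (info ε (z i) - Hb ε)|}) ≤ n * infoVar ε := by
    rw [← mul_assoc]
    convert h1 using 2
    ring
  exact le_of_mul_le_mul_left h2 hn'

theorem tendsto_weight_info_deviation {ε : ℝ} (h : ε ∈ Set.Icc (0 : ℝ) 1) {δ : ℝ}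
    (hδ : 0 < δ) :
    Tendsto (fun n : ℕ => weight (noiseLaw ε)
      {z : Fin n → ZMod 2 | n * δ ≤ |∑ i, (info ε (z i) - Hb ε)|}) atTop (𝓝 0) := by
  have hlim : Tendsto (fun n : ℕ => infoVar ε / δ ^ 2 / (n : ℝ)) atTop (𝓝 0) :=
    tendsto_const_div_atTop_nhds_zero_nat _
  refine tendsto_of_tendsto_of_tendsto_of_le_of_le' tendsto_const_nhds hlim
    (Eventually.of_forall fun n => weight_nonneg (noiseLaw_nonneg h) _) ?_
  filter_upwards [eventually_gt_atTop 0] with n hn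
  have hn' : (0 : ℝ) < n := by exact_mod_cast hn
  rw [div_div, le_div_iff₀ (by positivity)]
  have := weight_info_deviation_le h hδ n
  linarith

/-- Nonvanishing is essential: `Real.logb 2 0 = 0` gives an impossible symbol self-information zero,
and the formula would fail for `ε = 0` or `ε = 1`. -/
theorem noiseLaw_eq_rpow {ε : ℝ} (h : ε ∈ Set.Icc (0 : ℝ) 1) {n : ℕ} {z : Fin n → ZMod 2}
    (hz : noiseLaw ε z ≠ 0) :
    noiseLaw ε z = (2 : ℝ) ^ (-(n * Hb ε + ∑ i, (info ε (z i) - Hb ε))) := by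
  have hpos : ∀ i, 0 < bern ε (z i) := fun i =>
    lt_of_le_of_ne (bern_nonneg h _) (Ne.symm (Finset.prod_ne_zero_iff.1 hz i (Finset.mem_univ i)))
  have : -(n * Hb ε + ∑ i, (info ε (z i) - Hb ε)) = ∑ i, Real.logb 2 (bern ε (z i)) := by
    simp only [info, Finset.sum_sub_distrib, Finset.sum_neg_distrib, Finset.sum_const,
      Finset.card_univ, Fintype.card_fin, nsmul_eq_mul]
    ring
  rw [this, Real.rpow_sum_of_pos (by norm_num)]
  exact Finset.prod_congr rfl fun i _ =>
    (Real.rpow_logb (by norm_num) (by norm_num) (hpos i)).symm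

/-- The noise vectors that are not too unlikely. -/
noncomputable def typical (ε δ : ℝ) (n : ℕ) : Finset (Fin n → ZMod 2) :=
  {z | (2 : ℝ) ^ (-(n * (Hb ε + δ))) ≤ noiseLaw ε z}

theorem mem_typical {ε δ : ℝ} {n : ℕ} {z : Fin n → ZMod 2} :
    z ∈ typical ε δ n ↔ (2 : ℝ) ^ (-(n * (Hb ε + δ))) ≤ noiseLaw ε z := by
  simp [typical]

/-- The total probability is one and each member has at least the threshold probability, so a lower
bound on probabilities alone limits the size. -/
theorem card_typical_le {ε : ℝ} (h : ε ∈ Set.Icc (0 : ℝ) 1) (δ : ℝ) (n : ℕ) :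
    ((typical ε δ n).card : ℝ) ≤ 2 ^ (n * (Hb ε + δ)) := by
  have h1 : (typical ε δ n).card * (2 : ℝ) ^ (-(n * (Hb ε + δ))) ≤ 1 := by
    rw [← noiseLaw_sum (ι := Fin n) (ε := ε), ← nsmul_eq_mul]
    exact (Finset.card_nsmul_le_sum _ _ _ fun z hz => mem_typical.1 hz).trans
      (Finset.sum_le_sum_of_subset_of_nonneg (Finset.subset_univ _)
        fun z _ _ => noiseLaw_nonneg h z)
  rwa [Real.rpow_neg (by norm_num), ← div_eq_mul_inv, div_le_one (by positivity)] at h1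

theorem tendsto_weight_typical_compl {ε : ℝ} (h : ε ∈ Set.Icc (0 : ℝ) 1) {δ : ℝ} (hδ : 0 < δ) :
    Tendsto (fun n : ℕ => weight (noiseLaw ε) {z : Fin n → ZMod 2 | z ∉ typical ε δ n})
      atTop (𝓝 0) := by
  refine squeeze_zero (fun n => weight_nonneg (noiseLaw_nonneg h) _) (fun n => ?_)
    (tendsto_weight_info_deviation h hδ)
  refine Finset.sum_le_sum fun z _ => ?_
  have h0 := noiseLaw_nonneg h z
  by_cases hz : z ∈ {z | z ∉ typical ε δ n}
  · rw [Set.indicator_of_mem hz]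
    -- Impossible vectors carry no weight; for the others the exponent formula turns a small
    -- probability into a large deviation.
    by_cases hp : noiseLaw ε z = 0
    · rw [hp]
      exact Set.indicator_nonneg (fun z _ => noiseLaw_nonneg h z) _
    refine (Set.indicator_of_mem ?_ _).ge
    rw [Set.mem_ofPred_eq, mem_typical, noiseLaw_eq_rpow h hp, not_le,
      Real.rpow_lt_rpow_left_iff (by norm_num)] at hz
    rw [Set.mem_ofPred_eq]
    refine le_trans ?_ (le_abs_self _)
    linarith
  · rw [Set.indicator_of_notMem hz]
    exact Set.indicator_nonneg (fun z _ => noiseLaw_nonneg h z) _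

theorem tendsto_weight_likely {ε : ℝ} (h : ε ∈ Set.Icc (0 : ℝ) 1) {δ : ℝ} (hδ : 0 < δ) :
    Tendsto (fun n : ℕ => weight (noiseLaw ε)
      {z : Fin n → ZMod 2 | (2 : ℝ) ^ (-(n * (Hb ε - δ))) < noiseLaw ε z}) atTop (𝓝 0) := by
  refine squeeze_zero (fun n => weight_nonneg (noiseLaw_nonneg h) _) (fun n => ?_)
    (tendsto_weight_info_deviation h hδ)
  refine weight_mono (noiseLaw_nonneg h) fun z hz => ?_
  have h2 : (0 : ℝ) < 2 ^ (-(n * (Hb ε - δ))) := by positivity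
  rw [Set.mem_ofPred_eq] at hz
  rw [noiseLaw_eq_rpow h (h2.trans hz).ne', Real.rpow_lt_rpow_left_iff (by norm_num)] at hz
  rw [Set.mem_ofPred_eq]
  refine le_trans ?_ (neg_le_abs _)
  linarith

/-! ### Joint law of the three noises -/

/-- A triple of blocks of length `n`. -/
abbrev Blocks (n : ℕ) : Type :=
  (Fin n → ZMod 2) × (Fin n → ZMod 2) × (Fin n → ZMod 2)

/-- The joint law of the three noise blocks. -/
noncomputable def jointLaw (ε₁ ε₂ ε₃ : ℝ) {n : ℕ} (z : Blocks n) : ℝ :=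
  noiseLaw ε₁ z.1 * noiseLaw ε₂ z.2.1 * noiseLaw ε₃ z.2.2

section JointLaw

variable {ε₁ ε₂ ε₃ : ℝ} {n : ℕ}

theorem jointLaw_nonneg (h₁ : ε₁ ∈ Set.Icc (0 : ℝ) 1) (h₂ : ε₂ ∈ Set.Icc (0 : ℝ) 1)
    (h₃ : ε₃ ∈ Set.Icc (0 : ℝ) 1) (z : Blocks n) : 0 ≤ jointLaw ε₁ ε₂ ε₃ z :=
  mul_nonneg (mul_nonneg (noiseLaw_nonneg h₁ _) (noiseLaw_nonneg h₂ _)) (noiseLaw_nonneg h₃ _)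

/-- Conditioning on two noise blocks; this and its two variants reduce the converse to single binary
symmetric channels. -/
theorem weight_jointLaw_eq₁ (S : Set (Blocks n)) :
    weight (jointLaw ε₁ ε₂ ε₃) S = ∑ z₂, ∑ z₃, noiseLaw ε₂ z₂ * noiseLaw ε₃ z₃ *
      weight (noiseLaw ε₁) {z₁ | (z₁, z₂, z₃) ∈ S} := by
  classical
  simp only [weight, Fintype.sum_prod_type, Finset.mul_sum]
  rw [Finset.sum_comm]
  refine Finset.sum_congr rfl fun z₂ _ => ?_
  rw [Finset.sum_comm]
  refine Finset.sum_congr rfl fun z₃ _ => Finset.sum_congr rfl fun z₁ _ => ?_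
  simp only [Set.indicator_apply, Set.mem_ofPred_eq, jointLaw, mul_ite, mul_zero]
  congr 1
  ring

theorem weight_jointLaw_eq₂ (S : Set (Blocks n)) :
    weight (jointLaw ε₁ ε₂ ε₃) S = ∑ z₁, ∑ z₃, noiseLaw ε₁ z₁ * noiseLaw ε₃ z₃ *
      weight (noiseLaw ε₂) {z₂ | (z₁, z₂, z₃) ∈ S} := by
  classical
  simp only [weight, Fintype.sum_prod_type, Finset.mul_sum]
  refine Finset.sum_congr rfl fun z₂ _ => ?_
  rw [Finset.sum_comm]
  refine Finset.sum_congr rfl fun z₃ _ => Finset.sum_congr rfl fun z₁ _ => ?_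
  simp only [Set.indicator_apply, Set.mem_ofPred_eq, jointLaw, mul_ite, mul_zero]
  congr 1
  ring

theorem weight_jointLaw_eq₃ (S : Set (Blocks n)) :
    weight (jointLaw ε₁ ε₂ ε₃) S = ∑ z₁, ∑ z₂, noiseLaw ε₁ z₁ * noiseLaw ε₂ z₂ *
      weight (noiseLaw ε₃) {z₃ | (z₁, z₂, z₃) ∈ S} := by
  classical
  simp only [weight, Fintype.sum_prod_type, Finset.mul_sum]
  refine Finset.sum_congr rfl fun z₂ _ => Finset.sum_congr rfl fun z₃ _ =>
    Finset.sum_congr rfl fun z₁ _ => ?_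
  simp only [Set.indicator_apply, Set.mem_ofPred_eq, jointLaw, mul_ite, mul_zero]

theorem sum_mul_noiseLaw_le {W : Type*} [Fintype W] {ε ε' : ℝ} (h : ε ∈ Set.Icc (0 : ℝ) 1)
    (h' : ε' ∈ Set.Icc (0 : ℝ) 1) {f : W → (Fin n → ZMod 2) → (Fin n → ZMod 2) → ℝ} {B : ℝ}
    (hf : ∀ z z', ∑ w, f w z z' ≤ B) :
    ∑ w, ∑ z, ∑ z', noiseLaw ε z * noiseLaw ε' z' * f w z z' ≤ B := by
  rw [Finset.sum_comm]
  have h1 : ∑ z : Fin n → ZMod 2, ∑ z' : Fin n → ZMod 2, noiseLaw ε z * noiseLaw ε' z' * B = B := by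
    simp only [← Finset.sum_mul, ← Finset.mul_sum, noiseLaw_sum, one_mul, mul_one]
  rw [← h1]
  refine Finset.sum_le_sum fun z _ => ?_
  rw [Finset.sum_comm]
  refine Finset.sum_le_sum fun z' _ => ?_
  rw [← Finset.mul_sum]
  exact mul_le_mul_of_nonneg_left (hf z z')
    (mul_nonneg (noiseLaw_nonneg h z) (noiseLaw_nonneg h' z'))

theorem jointLaw_sum : ∑ z : Blocks n, jointLaw ε₁ ε₂ ε₃ z = 1 := by
  have h := weight_jointLaw_eq₃ (ε₁ := ε₁) (ε₂ := ε₂) (ε₃ := ε₃) (n := n) Set.univ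
  simpa only [weight, Set.indicator_univ, Set.mem_univ, Set.ofPred_true, noiseLaw_sum, mul_one,
    ← Finset.mul_sum] using h

theorem weight_jointLaw_fst (S : Set (Fin n → ZMod 2)) :
    weight (jointLaw ε₁ ε₂ ε₃) {z : Blocks n | z.1 ∈ S} = weight (noiseLaw ε₁) S := by
  rw [weight_jointLaw_eq₁]
  simp only [Set.mem_ofPred_eq, ← Finset.sum_mul, ← Finset.mul_sum, noiseLaw_sum, one_mul,
    mul_one]
  rfl

theorem weight_jointLaw_snd (S : Set (Fin n → ZMod 2)) :
    weight (jointLaw ε₁ ε₂ ε₃) {z : Blocks n | z.2.1 ∈ S} = weight (noiseLaw ε₂) S := by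
  rw [weight_jointLaw_eq₂]
  simp only [Set.mem_ofPred_eq, ← Finset.sum_mul, ← Finset.mul_sum, noiseLaw_sum, one_mul,
    mul_one]
  rfl

theorem weight_jointLaw_trd (S : Set (Fin n → ZMod 2)) :
    weight (jointLaw ε₁ ε₂ ε₃) {z : Blocks n | z.2.2 ∈ S} = weight (noiseLaw ε₃) S := by
  rw [weight_jointLaw_eq₃]
  simp only [Set.mem_ofPred_eq, ← Finset.sum_mul, ← Finset.mul_sum, noiseLaw_sum, one_mul,
    mul_one]
  rfl

end JointLaw

/-! ### From channel outputs to noise -/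

section Received

variable {W₁ W₂ W₃ : Type} {n : ℕ}

/-- The relay input for a given relay output block. -/
def relayInput (c : Code (ZMod 2) (ZMod 2) (ZMod 2) (ZMod 2) (ZMod 2) (ZMod 2) W₁ W₂ W₃ n)
    (w₃ : W₃) (y : Fin n → ZMod 2) (j : Fin n) : ZMod 2 :=
  c.g j w₃ fun i => y (Fin.castLE j.isLt.le i)

/-- The output blocks as functions of the messages and the noise blocks. -/
def received (c : Code (ZMod 2) (ZMod 2) (ZMod 2) (ZMod 2) (ZMod 2) (ZMod 2) W₁ W₂ W₃ n)
    (w : W₁ × W₂ × W₃) (z : Blocks n) : Blocks n :=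
  (c.f₁ w.1 + relayInput c w.2.2 (c.f₁ w.1 + c.f₂ w.2.1 + z.2.2) + z.1,
    c.f₂ w.2.1 + relayInput c w.2.2 (c.f₁ w.1 + c.f₂ w.2.1 + z.2.2) + z.2.1,
    c.f₁ w.1 + c.f₂ w.2.1 + z.2.2)

/-- For fixed messages, the noise blocks and the output blocks determine each other. -/
def receivedEquiv (c : Code (ZMod 2) (ZMod 2) (ZMod 2) (ZMod 2) (ZMod 2) (ZMod 2) W₁ W₂ W₃ n)
    (w : W₁ × W₂ × W₃) : Blocks n ≃ Blocks n where
  toFun := received c w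
  invFun y := (y.1 - (c.f₁ w.1 + relayInput c w.2.2 y.2.2),
    y.2.1 - (c.f₂ w.2.1 + relayInput c w.2.2 y.2.2), y.2.2 - (c.f₁ w.1 + c.f₂ w.2.1))
  left_inv z := by simp [received]
  right_inv y := by simp [received]

variable {ε₁ ε₂ ε₃ : ℝ} (h₁ : ε₁ ∈ Set.Icc (0 : ℝ) 1) (h₂ : ε₂ ∈ Set.Icc (0 : ℝ) 1)
  (h₃ : ε₃ ∈ Set.Icc (0 : ℝ) 1)

theorem bsChannel_prob_add (x₁ x₂ x₃ z₁ z₂ z₃ : ZMod 2) :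
    (bsChannel ε₁ ε₂ ε₃ h₁ h₂ h₃).prob x₁ x₂ x₃ (x₁ + x₃ + z₁, x₂ + x₃ + z₂, x₁ + x₂ + z₃) =
      bern ε₁ z₁ * bern ε₂ z₂ * bern ε₃ z₃ := by
  simp only [bsChannel, Prod.mk.injEq, add_right_inj, ite_and]
  simp

theorem outputLaw_received
    (c : Code (ZMod 2) (ZMod 2) (ZMod 2) (ZMod 2) (ZMod 2) (ZMod 2) W₁ W₂ W₃ n)
    (w : W₁ × W₂ × W₃) (z : Blocks n) :
    outputLaw (bsChannel ε₁ ε₂ ε₃ h₁ h₂ h₃) c w (received c w z) = jointLaw ε₁ ε₂ ε₃ z := by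
  rw [outputLaw, jointLaw, noiseLaw, noiseLaw, noiseLaw, ← Finset.prod_mul_distrib,
    ← Finset.prod_mul_distrib]
  exact Finset.prod_congr rfl fun j _ => bsChannel_prob_add h₁ h₂ h₃ _ _ _ _ _ _

/-- The relay input depends on the noise only through `y₃`, and `y₃` does not involve the relay
input; hence noise and outputs correspond bijectively, with equal weights. -/
theorem weight_outputLaw
    (c : Code (ZMod 2) (ZMod 2) (ZMod 2) (ZMod 2) (ZMod 2) (ZMod 2) W₁ W₂ W₃ n)
    (w : W₁ × W₂ × W₃) (E : Set (Blocks n)) :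
    weight (outputLaw (bsChannel ε₁ ε₂ ε₃ h₁ h₂ h₃) c w) E =
      weight (jointLaw ε₁ ε₂ ε₃) (received c w ⁻¹' E) :=
  (weight_equiv (receivedEquiv c w) (fun z => (outputLaw_received h₁ h₂ h₃ c w z).symm) E).symm

variable [Fintype W₁] [Fintype W₂] [Fintype W₃]

theorem avgProb_eq
    (c : Code (ZMod 2) (ZMod 2) (ZMod 2) (ZMod 2) (ZMod 2) (ZMod 2) W₁ W₂ W₃ n)
    (E : W₁ × W₂ × W₃ → Set (Blocks n)) :
    avgProb (bsChannel ε₁ ε₂ ε₃ h₁ h₂ h₃) c E = (1 / (Fintype.card (W₁ × W₂ × W₃) : ℝ)) *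
      ∑ w, weight (jointLaw ε₁ ε₂ ε₃) (received c w ⁻¹' E w) := by
  simp only [← weight_outputLaw h₁ h₂ h₃]
  rfl

theorem avgProb_nonneg
    (c : Code (ZMod 2) (ZMod 2) (ZMod 2) (ZMod 2) (ZMod 2) (ZMod 2) W₁ W₂ W₃ n)
    (E : W₁ × W₂ × W₃ → Set (Blocks n)) :
    0 ≤ avgProb (bsChannel ε₁ ε₂ ε₃ h₁ h₂ h₃) c E := by
  rw [avgProb_eq]
  exact mul_nonneg (by positivity)
    (Finset.sum_nonneg fun w _ => weight_nonneg (jointLaw_nonneg h₁ h₂ h₃) _)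

theorem avgProb_le
    (c : Code (ZMod 2) (ZMod 2) (ZMod 2) (ZMod 2) (ZMod 2) (ZMod 2) W₁ W₂ W₃ n)
    {E : W₁ × W₂ × W₃ → Set (Blocks n)} {B : ℝ} (hB : 0 ≤ B)
    (h : ∀ w, weight (jointLaw ε₁ ε₂ ε₃) (received c w ⁻¹' E w) ≤ B) :
    avgProb (bsChannel ε₁ ε₂ ε₃ h₁ h₂ h₃) c E ≤ B := by
  rw [avgProb_eq]
  have h1 := Finset.sum_le_card_nsmul Finset.univ _ B fun w _ => h w
  rw [Finset.card_univ, nsmul_eq_mul] at h1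
  -- For an empty message set the average is `0`, because `1 / 0 = 0`; this is where `0 ≤ B` enters.
  rcases Nat.eq_zero_or_pos (Fintype.card (W₁ × W₂ × W₃)) with h0 | h0
  · rw [h0]
    simpa using hB
  · have h0' : (0 : ℝ) < Fintype.card (W₁ × W₂ × W₃) := by exact_mod_cast h0
    rw [one_div, inv_mul_le_iff₀ h0']
    exact h1

/-- If the messages are decoded correctly only within the events `E`, the average probability
of correct decoding is at most that of `E`. -/
theorem one_sub_errorProb_le [Nonempty (W₁ × W₂ × W₃)]
    (c : Code (ZMod 2) (ZMod 2) (ZMod 2) (ZMod 2) (ZMod 2) (ZMod 2) W₁ W₂ W₃ n)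
    {E : W₁ × W₂ × W₃ → Set (Blocks n)}
    (hE : ∀ w z, c.h₁ (received c w z).1 = w → c.h₂ (received c w z).2.1 = w → z ∈ E w)
    {B : ℝ} (hB : ∑ w, weight (jointLaw ε₁ ε₂ ε₃) (E w) ≤ Fintype.card (W₁ × W₂ × W₃) * B) :
    1 - errorProb (bsChannel ε₁ ε₂ ε₃ h₁ h₂ h₃) c ≤ B := by
  have h0 : (0 : ℝ) < Fintype.card (W₁ × W₂ × W₃) := by exact_mod_cast Fintype.card_pos
  rw [errorProb, avgProb_eq, one_div]
  refine le_of_mul_le_mul_left (le_trans ?_ hB) h0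
  rw [mul_sub, mul_inv_cancel_left₀ h0.ne', mul_one, sub_le_iff_le_add, ← Finset.sum_add_distrib]
  have h1 : ∑ w : W₁ × W₂ × W₃, ∑ z : Blocks n, jointLaw ε₁ ε₂ ε₃ z =
      Fintype.card (W₁ × W₂ × W₃) := by
    simp only [jointLaw_sum, Finset.sum_const, Finset.card_univ, nsmul_eq_mul, mul_one]
  rw [← h1]
  refine Finset.sum_le_sum fun w _ => ?_
  rw [← weight_add_compl (E w)]
  refine add_le_add_right (weight_mono (jointLaw_nonneg h₁ h₂ h₃) fun z hz => ?_) _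
  by_contra hz'
  simp only [Set.mem_preimage, Set.mem_ofPred_eq, not_or, not_not] at hz'
  exact hz (hE w z hz'.1 hz'.2)

/-! ### Counting bounds on correct decoding -/

/-- The number of messages that can be told apart in additive noise is limited by the number
of sequences and by the probability of the likely noise sequences. -/
theorem sum_weight_decode_le {W : Type*} [Fintype W] {ε : ℝ} (h : ε ∈ Set.Icc (0 : ℝ) 1)
    (D : (Fin n → ZMod 2) → W) (c : W → Fin n → ZMod 2) {τ : ℝ} (hτ : 0 ≤ τ) :
    ∑ w, weight (noiseLaw ε) {z | D (c w + z) = w} ≤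
      Fintype.card W * weight (noiseLaw ε) {z : Fin n → ZMod 2 | τ < noiseLaw ε z} +
        2 ^ n * τ := by
  classical
  -- A correctly decoded noise vector is either likely or costs at most `τ`, charged to the output
  -- `c w + z`. Each output is decoded to a single message, so the charges over all messages total
  -- `2 ^ n * τ`.
  have h1 : ∀ w, weight (noiseLaw ε) {z | D (c w + z) = w} ≤
      weight (noiseLaw ε) {z : Fin n → ZMod 2 | τ < noiseLaw ε z} +
        ∑ y, if D y = w then τ else 0 := fun w => by
    rw [← Equiv.sum_comp (Equiv.addLeft (c w)) fun y => if D y = w then τ else 0, weight,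
      weight, ← Finset.sum_add_distrib]
    refine Finset.sum_le_sum fun z _ => ?_
    have h0 := noiseLaw_nonneg h z
    by_cases hz : D (c w + z) = w <;> by_cases hz' : τ < noiseLaw ε z <;>
      simp [hz, hz'] <;> linarith
  refine (Finset.sum_le_sum fun w _ => h1 w).trans ?_
  rw [Finset.sum_add_distrib, Finset.sum_const, Finset.card_univ, nsmul_eq_mul, Finset.sum_comm]
  simp

/-- The upper bound on the probability of correct decoding of one of `M` messages that are sent
over a binary symmetric channel. -/
noncomputable def successBound (ε δ : ℝ) (n : ℕ) (M : ℝ) : ℝ :=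
  weight (noiseLaw ε) {z : Fin n → ZMod 2 | (2 : ℝ) ^ (-(n * (Hb ε - δ))) < noiseLaw ε z} +
    2 ^ (n * (1 - Hb ε + δ)) / M

theorem sum_weight_decode_le_card_mul {W : Type*} [Fintype W] [Nonempty W] {ε : ℝ}
    (h : ε ∈ Set.Icc (0 : ℝ) 1) (D : (Fin n → ZMod 2) → W) (c : W → Fin n → ZMod 2) (δ : ℝ) :
    ∑ w, weight (noiseLaw ε) {z | D (c w + z) = w} ≤
      Fintype.card W * successBound ε δ n (Fintype.card W) := by
  have h0 : (0 : ℝ) < Fintype.card W := by exact_mod_cast Fintype.card_pos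
  refine (sum_weight_decode_le h D c
    (τ := (2 : ℝ) ^ (-(n * (Hb ε - δ)))) (by positivity)).trans_eq ?_
  rw [successBound, mul_add, mul_div_cancel₀ _ h0.ne', ← Real.rpow_natCast 2 n,
    ← Real.rpow_add (by norm_num)]
  congr 2
  ring

variable [Nonempty W₁] [Nonempty W₂] [Nonempty W₃]

/-- Once `z₂` and `z₃` are fixed, the relay input is determined by the messages, and receiver 1 sees
a codeword for all of them plus `z₁`. -/
theorem one_sub_errorProb_le_sum₁
    (c : Code (ZMod 2) (ZMod 2) (ZMod 2) (ZMod 2) (ZMod 2) (ZMod 2) W₁ W₂ W₃ n) (δ : ℝ) :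
    1 - errorProb (bsChannel ε₁ ε₂ ε₃ h₁ h₂ h₃) c ≤
      successBound ε₁ δ n (Fintype.card (W₁ × W₂ × W₃)) := by
  refine one_sub_errorProb_le h₁ h₂ h₃ c
    (E := fun w => {z | c.h₁ (received c w z).1 = w}) (fun w z h _ => h) ?_
  simp only [weight_jointLaw_eq₁]
  exact sum_mul_noiseLaw_le h₂ h₃ fun z₂ z₃ => sum_weight_decode_le_card_mul h₁ c.h₁
    (fun w => c.f₁ w.1 + relayInput c w.2.2 (c.f₁ w.1 + c.f₂ w.2.1 + z₃)) δ

theorem one_sub_errorProb_le_sum₂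
    (c : Code (ZMod 2) (ZMod 2) (ZMod 2) (ZMod 2) (ZMod 2) (ZMod 2) W₁ W₂ W₃ n) (δ : ℝ) :
    1 - errorProb (bsChannel ε₁ ε₂ ε₃ h₁ h₂ h₃) c ≤
      successBound ε₂ δ n (Fintype.card (W₁ × W₂ × W₃)) := by
  refine one_sub_errorProb_le h₁ h₂ h₃ c
    (E := fun w => {z | c.h₂ (received c w z).2.1 = w}) (fun w z _ h => h) ?_
  simp only [weight_jointLaw_eq₂]
  exact sum_mul_noiseLaw_le h₁ h₃ fun z₂ z₃ => sum_weight_decode_le_card_mul h₂ c.h₂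
    (fun w => c.f₂ w.2.1 + relayInput c w.2.2 (c.f₁ w.1 + c.f₂ w.2.1 + z₃)) δ

/-- Receiver 1 learns about `w₂` only through the relay: for fixed `w₁`, `w₃`, `z₁` its output is a
function of `y₃`. Composing with that function makes its decoder a decoder of `w₂` for the channel
with noise `z₃`. -/
theorem one_sub_errorProb_le_relay₂
    (c : Code (ZMod 2) (ZMod 2) (ZMod 2) (ZMod 2) (ZMod 2) (ZMod 2) W₁ W₂ W₃ n) (δ : ℝ) :
    1 - errorProb (bsChannel ε₁ ε₂ ε₃ h₁ h₂ h₃) c ≤ successBound ε₃ δ n (Fintype.card W₂) := by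
  refine one_sub_errorProb_le h₁ h₂ h₃ c
    (E := fun w => {z | (c.h₁ (received c w z).1).2.1 = w.2.1})
    (fun w z h _ => congrArg (fun v : W₁ × W₂ × W₃ => v.2.1) h) ?_
  simp only [weight_jointLaw_eq₃]
  refine sum_mul_noiseLaw_le h₁ h₂ fun z₁ z₂ => ?_
  have key : ∀ w₁ w₃, ∑ w₂, weight (noiseLaw ε₃)
      {z₃ | (z₁, z₂, z₃) ∈ {z | (c.h₁ (received c (w₁, w₂, w₃) z).1).2.1 = w₂}} ≤
        Fintype.card W₂ * successBound ε₃ δ n (Fintype.card W₂) := fun w₁ w₃ =>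
    sum_weight_decode_le_card_mul h₃
      (fun y => (c.h₁ (c.f₁ w₁ + relayInput c w₃ y + z₁)).2.1)
      (fun w₂ => c.f₁ w₁ + c.f₂ w₂) δ
  rw [Fintype.sum_prod_type]
  have key₂ : ∀ w₁ ∈ Finset.univ, ∑ v : W₂ × W₃, weight (noiseLaw ε₃)
      {z₃ | (z₁, z₂, z₃) ∈ {z | (c.h₁ (received c (w₁, v) z).1).2.1 = v.1}} ≤
        Fintype.card W₃ * (Fintype.card W₂ * successBound ε₃ δ n (Fintype.card W₂)) :=
      fun w₁ _ => by
    rw [Fintype.sum_prod_type_right]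
    refine (Finset.sum_le_card_nsmul _ _ _ fun w₃ _ => key w₁ w₃).trans_eq ?_
    rw [Finset.card_univ, nsmul_eq_mul]
  refine (Finset.sum_le_card_nsmul _ _ _ key₂).trans_eq ?_
  simp only [Finset.card_univ, nsmul_eq_mul, Fintype.card_prod]
  push_cast
  ring

theorem one_sub_errorProb_le_relay₁
    (c : Code (ZMod 2) (ZMod 2) (ZMod 2) (ZMod 2) (ZMod 2) (ZMod 2) W₁ W₂ W₃ n) (δ : ℝ) :
    1 - errorProb (bsChannel ε₁ ε₂ ε₃ h₁ h₂ h₃) c ≤ successBound ε₃ δ n (Fintype.card W₁) := by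
  refine one_sub_errorProb_le h₁ h₂ h₃ c
    (E := fun w => {z | (c.h₂ (received c w z).2.1).1 = w.1})
    (fun w z _ h => congrArg (fun v : W₁ × W₂ × W₃ => v.1) h) ?_
  simp only [weight_jointLaw_eq₃]
  refine sum_mul_noiseLaw_le h₁ h₂ fun z₁ z₂ => ?_
  rw [Fintype.sum_prod_type_right]
  have key : ∀ v ∈ Finset.univ, ∑ w₁, weight (noiseLaw ε₃)
      {z₃ | (z₁, z₂, z₃) ∈ {z | (c.h₂ (received c (w₁, v) z).2.1).1 = w₁}} ≤
        Fintype.card W₁ * successBound ε₃ δ n (Fintype.card W₁) := fun v _ => by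
    refine le_of_eq_of_le ?_ (sum_weight_decode_le_card_mul h₃
      (fun y => (c.h₂ (c.f₂ v.1 + relayInput c v.2 y + z₂)).1)
      (fun w₁ => c.f₁ w₁ + c.f₂ v.1) δ)
    rfl
  refine (Finset.sum_le_card_nsmul _ _ _ key).trans_eq ?_
  simp only [Finset.card_univ, nsmul_eq_mul, Fintype.card_prod]
  push_cast
  ring

end Received

/-- Above capacity both terms of the success bound vanish, although the success probability tends to
one. The constant `a` leaves room for rounding in the number of messages. -/
theorem rate_le_of_successBound {ε : ℝ} (h : ε ∈ Set.Icc (0 : ℝ) 1) {N : ℕ → ℕ}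
    (hN : Tendsto N atTop atTop) {e M : ℕ → ℝ} (he : Tendsto e atTop (𝓝 0)) {a R : ℝ}
    (ha : 0 < a) (hM : ∀ n, a * 2 ^ (N n * R) ≤ M n)
    (hs : ∀ δ n, 1 - e n ≤ successBound ε δ (N n) (M n)) : R ≤ 1 - Hb ε := by
  by_contra! hR
  -- Half the excess rate: the quotient in `successBound` is then at most `a⁻¹ * 2 ^ (-δ * N n)`.
  set δ := (R - (1 - Hb ε)) / 2 with hδ
  have hδ0 : 0 < δ := by linarith
  have hexp : Tendsto (fun n => a⁻¹ * ((2 : ℝ) ^ (-δ)) ^ N n) atTop (𝓝 (a⁻¹ * 0)) := by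
    refine ((tendsto_pow_atTop_nhds_zero_of_lt_one (by positivity) ?_).comp hN).const_mul _
    exact Real.rpow_lt_one_of_one_lt_of_neg (by norm_num) (by linarith)
  have hlim := ((tendsto_weight_likely h hδ0).comp hN).add hexp
  have h1 : Tendsto (fun n => 1 - e n) atTop (𝓝 (1 - 0)) := he.const_sub 1
  have := le_of_tendsto_of_tendsto' h1 hlim fun n => (hs δ n).trans ?_
  · norm_num at this
  refine add_le_add_right ?_ _
  have h2 : (0 : ℝ) < a * 2 ^ (N n * R) := by positivity
  refine (div_le_div_of_nonneg_left (by positivity) h2 (hM n)).trans_eq ?_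
  rw [← Real.rpow_natCast, ← Real.rpow_mul (by norm_num), div_eq_mul_inv, mul_inv,
    ← Real.rpow_neg (by norm_num), mul_left_comm, ← Real.rpow_add (by norm_num)]
  congr 2
  rw [hδ]
  ring

/-- The rates allowed by the relay's channel and, for their sum, by both receivers' channels. -/
def rateRegion (ε₁ ε₂ ε₃ : ℝ) : Set (ℝ × ℝ) :=
  {R | 0 ≤ R.1 ∧ 0 ≤ R.2 ∧ R.1 ≤ 1 - Hb ε₃ ∧ R.2 ≤ 1 - Hb ε₃ ∧
    R.1 + R.2 ≤ min (1 - Hb ε₁) (1 - Hb ε₂)}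

theorem isClosed_rateRegion (ε₁ ε₂ ε₃ : ℝ) : IsClosed (rateRegion ε₁ ε₂ ε₃) :=
  (isClosed_le continuous_const continuous_fst).inter <|
    (isClosed_le continuous_const continuous_snd).inter <|
    (isClosed_le continuous_fst continuous_const).inter <|
    (isClosed_le continuous_snd continuous_const).inter <|
    isClosed_le (continuous_fst.add continuous_snd) continuous_const

/-! ### The converse -/

section Converse

variable {ε₁ ε₂ ε₃ : ℝ} (h₁ : ε₁ ∈ Set.Icc (0 : ℝ) 1) (h₂ : ε₂ ∈ Set.Icc (0 : ℝ) 1)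
  (h₃ : ε₃ ∈ Set.Icc (0 : ℝ) 1)

/-- The converse, for any sequence of codes with vanishing error probability. -/
theorem mem_rateRegion {R₁ R₂ : ℝ} (hR₁ : 0 ≤ R₁) (hR₂ : 0 ≤ R₂) {N : ℕ → ℕ}
    (hN : Tendsto N atTop atTop) {W₁ W₂ W₃ : ℕ → Type} [∀ n, Fintype (W₁ n)]
    [∀ n, Fintype (W₂ n)] [∀ n, Fintype (W₃ n)] [∀ n, Nonempty (W₃ n)] {a : ℝ} (ha : 0 < a)
    (hM₁ : ∀ n, a * 2 ^ (N n * R₁) ≤ (Fintype.card (W₁ n) : ℝ))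
    (hM₂ : ∀ n, a * 2 ^ (N n * R₂) ≤ (Fintype.card (W₂ n) : ℝ))
    (c : ∀ n, Code (ZMod 2) (ZMod 2) (ZMod 2) (ZMod 2) (ZMod 2) (ZMod 2)
      (W₁ n) (W₂ n) (W₃ n) (N n))
    (hc : Tendsto (fun n => errorProb (bsChannel ε₁ ε₂ ε₃ h₁ h₂ h₃) (c n)) atTop (𝓝 0)) :
    (R₁, R₂) ∈ rateRegion ε₁ ε₂ ε₃ := by
  have i₁ : ∀ n, Nonempty (W₁ n) := fun n => by
    have h : (0 : ℝ) < Fintype.card (W₁ n) := lt_of_lt_of_le (by positivity) (hM₁ n)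
    exact Fintype.card_pos_iff.1 (by exact_mod_cast h)
  have i₂ : ∀ n, Nonempty (W₂ n) := fun n => by
    have h : (0 : ℝ) < Fintype.card (W₂ n) := lt_of_lt_of_le (by positivity) (hM₂ n)
    exact Fintype.card_pos_iff.1 (by exact_mod_cast h)
  have hM : ∀ n, a ^ 2 * 2 ^ (N n * (R₁ + R₂)) ≤
      (Fintype.card (W₁ n × W₂ n × W₃ n) : ℝ) := fun n => by
    have h3 : (1 : ℝ) ≤ Fintype.card (W₃ n) := by exact_mod_cast Fintype.card_pos
    have h4 := mul_le_mul (hM₁ n) (hM₂ n) (by positivity) (by positivity)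
    rw [Fintype.card_prod, Fintype.card_prod, mul_add, Real.rpow_add (by norm_num)]
    push_cast
    calc a ^ 2 * (2 ^ (N n * R₁) * 2 ^ (N n * R₂)) =
        a * 2 ^ (N n * R₁) * (a * 2 ^ (N n * R₂)) := by ring
      _ ≤ Fintype.card (W₁ n) * Fintype.card (W₂ n) * 1 := by rwa [mul_one]
      _ ≤ Fintype.card (W₁ n) * Fintype.card (W₂ n) * Fintype.card (W₃ n) := by gcongr
      _ = _ := by ring
  exact ⟨hR₁, hR₂,
    rate_le_of_successBound h₃ hN hc ha hM₁ fun δ n =>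
      one_sub_errorProb_le_relay₁ h₁ h₂ h₃ (c n) δ,
    rate_le_of_successBound h₃ hN hc ha hM₂ fun δ n =>
      one_sub_errorProb_le_relay₂ h₁ h₂ h₃ (c n) δ,
    le_min
      (rate_le_of_successBound h₁ hN hc (pow_pos ha 2) hM fun δ n =>
        one_sub_errorProb_le_sum₁ h₁ h₂ h₃ (c n) δ)
      (rate_le_of_successBound h₂ hN hc (pow_pos ha 2) hM fun δ n =>
        one_sub_errorProb_le_sum₂ h₁ h₂ h₃ (c n) δ)⟩

theorem mem_rateRegion_of_achievable {R : ℝ × ℝ}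
    (h : Achievable (bsChannel ε₁ ε₂ ε₃ h₁ h₂ h₃) R.1 R.2 0) : R ∈ rateRegion ε₁ ε₂ ε₃ := by
  obtain ⟨hR₁, hR₂, -, c, hc⟩ := h
  -- The constant `1 / 2` comes from `x ≤ 2 * ⌊x⌋` for `x ≥ 1`.
  have hM : ∀ S : ℝ, 0 ≤ S → ∀ n : ℕ, (1 / 2 : ℝ) * 2 ^ ((n : ℝ) * S) ≤
      (Fintype.card (Fin ⌊(2 : ℝ) ^ ((n : ℝ) * S)⌋₊) : ℝ) := fun S hS n => by
    rw [Fintype.card_fin]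
    have h1 : (1 : ℝ) ≤ 2 ^ ((n : ℝ) * S) := Real.one_le_rpow (by norm_num) (by positivity)
    have h2 : (1 : ℝ) ≤ ⌊(2 : ℝ) ^ ((n : ℝ) * S)⌋₊ := by
      exact_mod_cast Nat.le_floor (by exact_mod_cast h1)
    linarith [Nat.lt_floor_add_one ((2 : ℝ) ^ ((n : ℝ) * S))]
  have : ∀ n : ℕ, Nonempty (Fin ⌊(2 : ℝ) ^ ((n : ℝ) * 0)⌋₊) := fun n => ⟨⟨0, by simp⟩⟩
  exact mem_rateRegion h₁ h₂ h₃ hR₁ hR₂ tendsto_id (by norm_num) (hM _ hR₁) (hM _ hR₂) c hc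

theorem mem_rateRegion_of_linearAchievable {R : ℝ × ℝ}
    (h : LinearAchievable (bsChannel ε₁ ε₂ ε₃ h₁ h₂ h₃) R.1 R.2) :
    R ∈ rateRegion ε₁ ε₂ ε₃ := by
  obtain ⟨hR₁, hR₂, m, k₁, k₂, s, hk₁, hk₂, hc, -⟩ := h
  have hM : ∀ (S : ℝ) (k : ℕ → ℕ), (∀ n : ℕ, ((m : ℝ) + 1) * n * S ≤ m * k n) → ∀ n : ℕ,
      (1 : ℝ) * 2 ^ ((((m + 1) * n : ℕ) : ℝ) * S) ≤
        (Fintype.card (Fin m → Fin (k n) → ZMod 2) : ℝ) := fun S k hk n => by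
    rw [one_mul]
    simp only [Fintype.card_pi, Finset.prod_const, Finset.card_univ, Fintype.card_fin, ZMod.card]
    rw [← pow_mul]
    push_cast
    rw [← Real.rpow_natCast]
    refine Real.rpow_le_rpow_of_exponent_le (by norm_num) ?_
    push_cast
    rw [mul_comm (k n : ℝ)]
    exact hk n
  have hN : Tendsto (fun n : ℕ => (m + 1) * n) atTop atTop :=
    tendsto_id.const_mul_atTop' (Nat.succ_pos m)
  exact mem_rateRegion h₁ h₂ h₃ hR₁ hR₂ hN one_pos (hM _ _ hk₁) (hM _ _ hk₂)
    (fun n => (s n).toCode) hc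

end Converse

/-! ### Random linear codes -/

section RandomCode

variable {ι : Type*} [Fintype ι] [DecidableEq ι] {n : ℕ}

/-- The image of a nonzero vector under a uniform random matrix is uniform. -/
theorem sum_vecMul {c : ι → ZMod 2} (hc : c ≠ 0) (f : (Fin n → ZMod 2) → ℝ) :
    2 ^ n * ∑ M : Matrix ι (Fin n) (ZMod 2), f (c ᵥ* M) =
      Fintype.card (Matrix ι (Fin n) (ZMod 2)) * ∑ v, f v := by
  obtain ⟨i, hi⟩ := Function.ne_iff.1 hc
  -- A preimage of `v` has the single nonzero row `(c i)⁻¹ • v` at a position where `c` does not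
  -- vanish.
  have hsurj : ∀ v : Fin n → ZMod 2, ∃ M : Matrix ι (Fin n) (ZMod 2), c ᵥ* M = v := fun v => by
    refine ⟨Matrix.of fun j => if j = i then (c i)⁻¹ • v else 0, ?_⟩
    ext t
    have h1 : ∀ j, c j * (if j = i then (c i)⁻¹ • v else 0) t =
        if j = i then v t else 0 := fun j => by
      split_ifs with h
      · rw [h, Pi.smul_apply, smul_eq_mul, mul_inv_cancel_left₀ hi]
      · simp
    simp [Matrix.vecMul, dotProduct, h1]
  -- Translating the matrices by a preimage of `v` translates the image by `v`. The sum is thus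
  -- invariant under all translations, and summing over `v` replaces `c ᵥ* M` by a uniform vector.
  have hshift : ∀ v, ∑ M : Matrix ι (Fin n) (ZMod 2), f (c ᵥ* M) =
      ∑ M : Matrix ι (Fin n) (ZMod 2), f (v + c ᵥ* M) := fun v => by
    obtain ⟨M₀, rfl⟩ := hsurj v
    rw [← Equiv.sum_comp (Equiv.addLeft M₀) fun M => f (c ᵥ* M)]
    exact Finset.sum_congr rfl fun M _ => by rw [Equiv.coe_addLeft, Matrix.vecMul_add]
  have h2 : ∑ v : Fin n → ZMod 2, ∑ M : Matrix ι (Fin n) (ZMod 2), f (c ᵥ* M) =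
      ∑ v, ∑ M : Matrix ι (Fin n) (ZMod 2), f (v + c ᵥ* M) :=
    Finset.sum_congr rfl fun v _ => hshift v
  rw [Finset.sum_const, Finset.card_univ, nsmul_eq_mul, Finset.sum_comm] at h2
  have h3 : ∀ x : Fin n → ZMod 2, ∑ v, f (v + x) = ∑ v, f v := fun x =>
    Equiv.sum_comp (Equiv.addRight x) f
  simp only [h3, Finset.sum_const, Finset.card_univ, nsmul_eq_mul] at h2
  rw [← h2]
  simp

/-- One nonzero coefficient vector suffices: with the other matrix fixed, its contribution is a mere
translation of a uniform vector. -/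
theorem sum_vecMul_add_vecMul {a b : ι → ZMod 2} (hab : (a, b) ≠ 0)
    (f : (Fin n → ZMod 2) → ℝ) :
    2 ^ n * ∑ M : Matrix ι (Fin n) (ZMod 2) × Matrix ι (Fin n) (ZMod 2),
        f (a ᵥ* M.1 + b ᵥ* M.2) =
      Fintype.card (Matrix ι (Fin n) (ZMod 2) × Matrix ι (Fin n) (ZMod 2)) * ∑ v, f v := by
  have h3 : ∀ x : Fin n → ZMod 2, ∑ v, f (v + x) = ∑ v, f v := fun x =>
    Equiv.sum_comp (Equiv.addRight x) f
  have h4 : ∀ x : Fin n → ZMod 2, ∑ v, f (x + v) = ∑ v, f v := fun x =>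
    Equiv.sum_comp (Equiv.addLeft x) f
  rw [Fintype.card_prod, Nat.cast_mul]
  by_cases ha : a = 0
  · have hb : b ≠ 0 := fun hb => hab (by rw [ha, hb]; rfl)
    rw [Fintype.sum_prod_type, Finset.mul_sum]
    have h5 : ∀ M : Matrix ι (Fin n) (ZMod 2),
        2 ^ n * ∑ M', f (a ᵥ* M + b ᵥ* M') = _ := fun M =>
      (sum_vecMul hb fun v => f (a ᵥ* M + v)).trans (by rw [h4])
    simp only [h5, Finset.sum_const, Finset.card_univ, nsmul_eq_mul, mul_assoc]
  · rw [Fintype.sum_prod_type_right, Finset.mul_sum]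
    have h5 : ∀ M' : Matrix ι (Fin n) (ZMod 2),
        2 ^ n * ∑ M, f (a ᵥ* M + b ᵥ* M') = _ := fun M' =>
      (sum_vecMul ha fun v => f (v + b ᵥ* M')).trans (by rw [h3])
    simp only [h5, Finset.sum_const, Finset.card_univ, nsmul_eq_mul, mul_assoc]

/-- The noise vectors that are not in `T`, or that the addition of a combination of codewords
with coefficients in `A` takes to another element of `T`. -/
def confusable (T : Finset (Fin n → ZMod 2)) (A : Finset ((ι → ZMod 2) × (ι → ZMod 2)))
    (M : Matrix ι (Fin n) (ZMod 2) × Matrix ι (Fin n) (ZMod 2)) : Set (Fin n → ZMod 2) :=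
  {z | z ∉ T ∨ ∃ p ∈ A, z + (p.1 ᵥ* M.1 + p.2 ᵥ* M.2) ∈ T}

/-- Union bound over `A`: a combination with nonzero coefficients is uniform over the matrices, so
it takes a given `z` into `T` for a fraction `T.card / 2 ^ n` of them. -/
theorem sum_weight_confusable_le {ε : ℝ} (h : ε ∈ Set.Icc (0 : ℝ) 1)
    (T : Finset (Fin n → ZMod 2)) {A : Finset ((ι → ZMod 2) × (ι → ZMod 2))} (hA : 0 ∉ A) :
    ∑ M, weight (noiseLaw ε) (confusable T A M) ≤
      Fintype.card (Matrix ι (Fin n) (ZMod 2) × Matrix ι (Fin n) (ZMod 2)) *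
        (weight (noiseLaw ε) {z | z ∉ T} + A.card * T.card / 2 ^ n) := by
  have h1 : ∀ M, weight (noiseLaw ε) (confusable T A M) ≤ weight (noiseLaw ε) {z | z ∉ T} +
      ∑ z, noiseLaw ε z * ∑ p ∈ A,
        if z + (p.1 ᵥ* M.1 + p.2 ᵥ* M.2) ∈ T then 1 else 0 := fun M => by
    rw [weight, weight, ← Finset.sum_add_distrib]
    refine Finset.sum_le_sum fun z _ => ?_
    have h0 := noiseLaw_nonneg h z
    have hs : ∀ p ∈ A, (0 : ℝ) ≤ if z + (p.1 ᵥ* M.1 + p.2 ᵥ* M.2) ∈ T then 1 else 0 :=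
      fun p _ => by split_ifs <;> norm_num
    by_cases hz : z ∈ confusable T A M
    · rw [Set.indicator_of_mem hz]
      rcases hz with hz | ⟨p, hp, hz⟩
      · rw [Set.indicator_of_mem (by exact hz)]
        linarith [mul_nonneg h0 (Finset.sum_nonneg hs)]
      · have h2 := Finset.single_le_sum hs hp
        rw [if_pos hz] at h2
        have h3 : 0 ≤ Set.indicator {z | z ∉ T} (noiseLaw ε) z :=
          Set.indicator_nonneg (fun z _ => noiseLaw_nonneg h z) _
        nlinarith [mul_le_mul_of_nonneg_left h2 h0]
    · rw [Set.indicator_of_notMem hz]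
      exact add_nonneg (Set.indicator_nonneg (fun z _ => noiseLaw_nonneg h z) _)
        (mul_nonneg h0 (Finset.sum_nonneg hs))
  refine (Finset.sum_le_sum fun M _ => h1 M).trans_eq ?_
  rw [Finset.sum_add_distrib, Finset.sum_const, Finset.card_univ, nsmul_eq_mul, mul_add,
    Finset.sum_comm]
  congr 1
  have h5 : ∀ z : Fin n → ZMod 2, ∀ p ∈ A,
      ∑ M : Matrix ι (Fin n) (ZMod 2) × Matrix ι (Fin n) (ZMod 2),
        (if z + (p.1 ᵥ* M.1 + p.2 ᵥ* M.2) ∈ T then (1 : ℝ) else 0) =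
        Fintype.card (Matrix ι (Fin n) (ZMod 2) × Matrix ι (Fin n) (ZMod 2)) * T.card / 2 ^ n :=
      fun z p hp => by
    have h6 := sum_vecMul_add_vecMul (n := n) (fun h0 => hA (h0 ▸ hp))
      (fun v => if z + v ∈ T then (1 : ℝ) else 0) (a := p.1) (b := p.2)
    have h8 : ∑ v, (if z + v ∈ T then (1 : ℝ) else 0) = ∑ v, if v ∈ T then (1 : ℝ) else 0 :=
      Equiv.sum_comp (Equiv.addLeft z) fun v => if v ∈ T then (1 : ℝ) else 0
    rw [h8] at h6
    rw [eq_div_iff (by positivity), mul_comm, h6]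
    simp
  have h7 : ∀ z : Fin n → ZMod 2,
      ∑ M : Matrix ι (Fin n) (ZMod 2) × Matrix ι (Fin n) (ZMod 2), noiseLaw ε z *
        ∑ p ∈ A, (if z + (p.1 ᵥ* M.1 + p.2 ᵥ* M.2) ∈ T then (1 : ℝ) else 0) =
      noiseLaw ε z * (A.card *
        (Fintype.card (Matrix ι (Fin n) (ZMod 2) × Matrix ι (Fin n) (ZMod 2)) * T.card / 2 ^ n)) :=
      fun z => by
    rw [← Finset.mul_sum, Finset.sum_comm, Finset.sum_congr rfl (h5 z), Finset.sum_const,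
      nsmul_eq_mul]
  simp only [h7]
  rw [← Finset.sum_mul, noiseLaw_sum]
  ring

end RandomCode

/-! ### Padded messages and their differences -/

section Pad

variable {k l : ℕ}

theorem pad_zero : pad k (0 : Fin l → ZMod 2) = 0 := by
  ext i
  simp [pad]

theorem pad_sub (u v : Fin l → ZMod 2) : pad k (u - v) = pad k u - pad k v := by
  ext i
  simp only [pad, Pi.sub_apply]
  split_ifs <;> simp

theorem pad_injective (h : l ≤ k) : Function.Injective (pad k : (Fin l → ZMod 2) → _) := by
  intro u v huv
  ext i
  have h1 := congrFun huv ⟨i + (k - l), by omega⟩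
  simpa [pad] using h1

end Pad

/-- The nonzero differences of pairs of padded vectors. -/
def padDiffs (k l l' : ℕ) : Finset ((Fin k → ZMod 2) × (Fin k → ZMod 2)) :=
  ((Finset.univ : Finset ((Fin l → ZMod 2) × (Fin l' → ZMod 2))).erase 0).image
    fun p => (pad k p.1, pad k p.2)

/-- The nonzero differences of vectors encoded by the first of two matrices. -/
def leftDiffs (k : ℕ) : Finset ((Fin k → ZMod 2) × (Fin k → ZMod 2)) :=
  ((Finset.univ : Finset (Fin k → ZMod 2)).erase 0).image fun a => (a, 0)

theorem zero_notMem_padDiffs {k l l' : ℕ} (h : l ≤ k) (h' : l' ≤ k) : 0 ∉ padDiffs k l l' := by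
  simp only [padDiffs, Finset.mem_image, Finset.mem_erase, Finset.mem_univ, and_true, not_exists,
    not_and]
  rintro ⟨u, v⟩ huv h0
  refine huv (Prod.ext (pad_injective h ?_) (pad_injective h' ?_))
  · exact (congrArg Prod.fst h0).trans pad_zero.symm
  · exact (congrArg Prod.snd h0).trans pad_zero.symm

theorem zero_notMem_leftDiffs (k : ℕ) : 0 ∉ leftDiffs k := by
  simp only [leftDiffs, Finset.mem_image, Finset.mem_erase, Finset.mem_univ, and_true, not_exists,
    not_and]
  exact fun u hu h0 => hu (congrArg Prod.fst h0)

theorem card_padDiffs_le (k l l' : ℕ) : (padDiffs k l l').card ≤ 2 ^ (l + l') := by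
  refine Finset.card_image_le.trans ((Finset.card_erase_le).trans_eq ?_)
  simp [pow_add]

theorem card_leftDiffs_le (k : ℕ) : (leftDiffs k).card ≤ 2 ^ k := by
  refine Finset.card_image_le.trans ((Finset.card_erase_le).trans_eq ?_)
  simp

/-- A bound on the probability of decoding errors of a random linear code with `2 ^ k`
codewords. -/
noncomputable def linearBound (ε δ : ℝ) (n k : ℕ) : ℝ :=
  weight (noiseLaw ε) {z : Fin n → ZMod 2 | z ∉ typical ε δ n} +
    2 ^ k * (typical ε δ n).card / 2 ^ n

/-- There are two generator matrices that are good for the relay and for both receivers. -/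
theorem exists_matrices {ε₁ ε₂ ε₃ : ℝ} (h₁ : ε₁ ∈ Set.Icc (0 : ℝ) 1)
    (h₂ : ε₂ ∈ Set.Icc (0 : ℝ) 1) (h₃ : ε₃ ∈ Set.Icc (0 : ℝ) 1) (δ : ℝ) (n : ℕ) {k k₁ k₂ : ℕ}
    (hk₁ : k₁ ≤ k) (hk₂ : k₂ ≤ k) :
    ∃ M : Matrix (Fin k) (Fin n) (ZMod 2) × Matrix (Fin k) (Fin n) (ZMod 2),
      weight (noiseLaw ε₁) (confusable (typical ε₁ δ n) (padDiffs k k₁ k₂) M) +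
        weight (noiseLaw ε₂) (confusable (typical ε₂ δ n) (padDiffs k k₂ k₁) M) +
        weight (noiseLaw ε₃) (confusable (typical ε₃ δ n) (leftDiffs k) M) ≤
      linearBound ε₁ δ n (k₁ + k₂) + linearBound ε₂ δ n (k₁ + k₂) + linearBound ε₃ δ n k := by
  have key : ∀ {ε : ℝ} (h : ε ∈ Set.Icc (0 : ℝ) 1)
      {A : Finset ((Fin k → ZMod 2) × (Fin k → ZMod 2))} (hA : 0 ∉ A) {r : ℕ}
      (hr : A.card ≤ 2 ^ r), ∑ M, weight (noiseLaw ε) (confusable (typical ε δ n) A M) ≤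
        Fintype.card (Matrix (Fin k) (Fin n) (ZMod 2) × Matrix (Fin k) (Fin n) (ZMod 2)) *
          linearBound ε δ n r := fun {ε} h {A} hA {r} hr => by
    refine (sum_weight_confusable_le h _ hA).trans ?_
    have hr' : (A.card : ℝ) ≤ 2 ^ r := by exact_mod_cast hr
    unfold linearBound
    gcongr
  have e₁ := key h₁ (zero_notMem_padDiffs hk₁ hk₂) (card_padDiffs_le k k₁ k₂)
  have e₂ := key h₂ (zero_notMem_padDiffs hk₂ hk₁)
    ((card_padDiffs_le k k₂ k₁).trans_eq (by rw [add_comm]))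
  have e₃ := key h₃ (zero_notMem_leftDiffs k) (card_leftDiffs_le k)
  -- The average over all pairs of matrices obeys the bound. Averaging the sum of the three terms,
  -- not each separately, gives one pair that serves all three decoders.
  by_contra! hM
  have hlt := Finset.sum_lt_sum_of_nonempty Finset.univ_nonempty fun M _ => hM M
  simp only [Finset.sum_add_distrib, Finset.sum_const, Finset.card_univ, nsmul_eq_mul] at hlt
  linarith

/-! ### The block-Markov scheme and its decoders -/

section Blocks

variable {m n k l l' : ℕ}

/-- The message vector of block `b`, and zero outside the message blocks. -/
def blockAt (u : Fin m → Fin l → ZMod 2) (b : ℕ) : Fin l → ZMod 2 :=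
  if h : b < m then u ⟨b, h⟩ else 0

/-- The message vector of the block before block `b`, and zero for block `0`. -/
def prevAt (u : Fin m → Fin l → ZMod 2) (b : ℕ) : Fin l → ZMod 2 :=
  if b = 0 then 0 else blockAt u (b - 1)

/-- The noiseless output in block `b` of the receiver that hears the transmitter with
messages `u`, if the relay decodes correctly. -/
def signal (M : Matrix (Fin k) (Fin n) (ZMod 2) × Matrix (Fin k) (Fin n) (ZMod 2))
    (u : Fin m → Fin l → ZMod 2) (v : Fin m → Fin l' → ZMod 2) (b : ℕ) : Fin n → ZMod 2 :=
  pad k (blockAt u b) ᵥ* M.1 + (pad k (prevAt u b) + pad k (prevAt v b)) ᵥ* M.2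

/-- The part of a sequence in block `b`. -/
def blockOf (y : Fin ((m + 1) * n) → ZMod 2) (b : Fin (m + 1)) (i : Fin n) : ZMod 2 :=
  y (finProdFinEquiv (b, i))

/-- If no noise block is confusable, then the messages are the only ones for which all noise
blocks are in `T`. -/
theorem eq_of_signal {M : Matrix (Fin k) (Fin n) (ZMod 2) × Matrix (Fin k) (Fin n) (ZMod 2)}
    {T : Finset (Fin n → ZMod 2)} {u u' : Fin m → Fin l → ZMod 2} {v v' : Fin m → Fin l' → ZMod 2}
    {z : Fin (m + 1) → Fin n → ZMod 2}
    (hz : ∀ b, z b ∉ confusable T (padDiffs k l l') M)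
    (h : ∀ b : Fin (m + 1), signal M u v b + z b - signal M u' v' b ∈ T) : u' = u ∧ v' = v := by
  -- When the previous message of `u` is known, its relay contribution cancels in the difference of
  -- the signals. A wrong remaining pair would differ by an element of `padDiffs` that moves `z b`
  -- into `T`.
  have key : ∀ b : Fin (m + 1), prevAt u' b = prevAt u b →
      blockAt u' b = blockAt u b ∧ prevAt v' b = prevAt v b := fun b hb => by
    by_contra hne
    refine hz b (Or.inr ⟨_, Finset.mem_image.2
      ⟨(blockAt u b - blockAt u' b, prevAt v b - prevAt v' b), ?_, rfl⟩, ?_⟩)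
    · refine Finset.mem_erase.2 ⟨fun h0 => hne ?_, Finset.mem_univ _⟩
      exact ⟨(sub_eq_zero.1 (congrArg Prod.fst h0)).symm,
        (sub_eq_zero.1 (congrArg Prod.snd h0)).symm⟩
    · have h1 := h b
      convert h1 using 1
      simp only [signal, pad_sub, Matrix.sub_vecMul, Matrix.add_vecMul, hb]
      abel
  -- Forward induction: block `0` has no predecessor, and the message found in block `b` is the
  -- known predecessor in block `b + 1`.
  have hprev : ∀ b : ℕ, b ≤ m → prevAt u' b = prevAt u b := by
    intro b
    induction b with
    | zero => exact fun _ => rfl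
    | succ b ih =>
      intro hb
      have := (key ⟨b, by omega⟩ (ih (by omega))).1
      simpa [prevAt] using this
  constructor
  · funext b
    have := (key b.castSucc (hprev _ b.isLt.le)).1
    simpa [blockAt] using this
  · funext b
    -- Message `v b` reaches this receiver one block later, via the relay; for the last message this
    -- uses the additional block `m`.
    have := (key b.succ (hprev _ b.isLt)).2
    simpa [prevAt, blockAt] using this

open Classical in
/-- The joint decoder of a receiver for the messages of all blocks. -/
noncomputable def jointDecoder (m l l' : ℕ)
    (M : Matrix (Fin k) (Fin n) (ZMod 2) × Matrix (Fin k) (Fin n) (ZMod 2))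
    (T : Finset (Fin n → ZMod 2)) (y : Fin ((m + 1) * n) → ZMod 2) :
    (Fin m → Fin l → ZMod 2) × (Fin m → Fin l' → ZMod 2) :=
  if h : ∃ p : (Fin m → Fin l → ZMod 2) × (Fin m → Fin l' → ZMod 2),
    ∀ b, blockOf y b - signal M p.1 p.2 b ∈ T then h.choose else 0

theorem jointDecoder_eq {M : Matrix (Fin k) (Fin n) (ZMod 2) × Matrix (Fin k) (Fin n) (ZMod 2)}
    {T : Finset (Fin n → ZMod 2)} {u : Fin m → Fin l → ZMod 2} {v : Fin m → Fin l' → ZMod 2}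
    {y : Fin ((m + 1) * n) → ZMod 2} {z : Fin (m + 1) → Fin n → ZMod 2}
    (hz : ∀ b, z b ∉ confusable T (padDiffs k l l') M)
    (hy : ∀ b : Fin (m + 1), blockOf y b = signal M u v b + z b) :
    jointDecoder m l l' M T y = (u, v) := by
  have hex : ∃ p : (Fin m → Fin l → ZMod 2) × (Fin m → Fin l' → ZMod 2),
      ∀ b, blockOf y b - signal M p.1 p.2 b ∈ T := by
    refine ⟨(u, v), fun b => ?_⟩
    rw [hy, add_sub_cancel_left]
    by_contra hT
    exact hz b (Or.inl hT)
  rw [jointDecoder, dif_pos hex]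
  have h1 := hex.choose_spec
  have h2 := eq_of_signal hz fun b => by rw [← hy]; exact h1 b
  exact Prod.ext h2.1 h2.2

open Classical in
/-- The relay's decoder. -/
noncomputable def sumDecoder (G : Matrix (Fin k) (Fin n) (ZMod 2)) (T : Finset (Fin n → ZMod 2))
    (y : Fin n → ZMod 2) : Fin k → ZMod 2 :=
  if h : ∃ u, y - u ᵥ* G ∈ T then h.choose else 0

theorem sumDecoder_eq {M : Matrix (Fin k) (Fin n) (ZMod 2) × Matrix (Fin k) (Fin n) (ZMod 2)}
    {T : Finset (Fin n → ZMod 2)} {z : Fin n → ZMod 2} (hz : z ∉ confusable T (leftDiffs k) M)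
    (u : Fin k → ZMod 2) : sumDecoder M.1 T (u ᵥ* M.1 + z) = u := by
  have hex : ∃ v, u ᵥ* M.1 + z - v ᵥ* M.1 ∈ T := by
    refine ⟨u, ?_⟩
    rw [add_sub_cancel_left]
    by_contra hT
    exact hz (Or.inl hT)
  rw [sumDecoder, dif_pos hex]
  by_contra hne
  refine hz (Or.inr ⟨_, Finset.mem_image.2 ⟨u - hex.choose, ?_, rfl⟩, ?_⟩)
  · exact Finset.mem_erase.2 ⟨fun h0 => hne (sub_eq_zero.1 h0).symm, Finset.mem_univ _⟩
  · convert hex.choose_spec using 1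
    simp only [Matrix.sub_vecMul, Matrix.zero_vecMul]
    abel

/-- The scheme with the given generator matrices and typical set decoders. -/
noncomputable def linearScheme (m : ℕ) {n k₁ k₂ : ℕ}
    (M : Matrix (Fin (max k₁ k₂)) (Fin n) (ZMod 2) × Matrix (Fin (max k₁ k₂)) (Fin n) (ZMod 2))
    (T₁ T₂ T₃ : Finset (Fin n → ZMod 2)) : LinearScheme m n k₁ k₂ where
  G := M.1
  G₃ := M.2
  dec := sumDecoder M.1 T₃
  h₁ y := jointDecoder m k₁ k₂ M T₁ y
  -- Receiver 2 hears transmitter 2 directly, so the roles of the two messages are exchanged.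
  h₂ y := (jointDecoder m k₂ k₁ M T₂ y).swap

theorem blockOf_encodeBlocks (G : Matrix (Fin k) (Fin n) (ZMod 2)) (u : Fin m → Fin l → ZMod 2)
    (b : Fin (m + 1)) : blockOf (encodeBlocks G u) b = pad k (blockAt u b) ᵥ* G := by
  funext i
  have h := finProdFinEquiv.symm_apply_apply (b, i)
  have h1 : (finProdFinEquiv (b, i)).divNat = b := congrArg Prod.fst h
  have h2 : (finProdFinEquiv (b, i)).modNat = i := congrArg Prod.snd h
  rw [blockOf, encodeBlocks, blockAt]
  simp only [h1, h2]
  split_ifs with hb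
  · rfl
  · rw [pad_zero, Matrix.zero_vecMul, Pi.zero_apply]

variable {k₁ k₂ : ℕ}

theorem blockOf_relayInput (s : LinearScheme m n k₁ k₂) (y : Fin ((m + 1) * n) → ZMod 2)
    (b : Fin (m + 1)) :
    blockOf (relayInput s.toCode () y) b =
      if h : 1 ≤ (b : ℕ) then s.dec (blockOf y ⟨b - 1, by omega⟩) ᵥ* s.G₃ else 0 := by
  funext i
  have h := finProdFinEquiv.symm_apply_apply (b, i)
  have h1 : (finProdFinEquiv (b, i)).divNat = b := congrArg Prod.fst h
  have h2 : (finProdFinEquiv (b, i)).modNat = i := congrArg Prod.snd h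
  rw [blockOf, relayInput, LinearScheme.toCode]
  simp only [h1, h2]
  split_ifs with hb
  · congr 3
    funext i'
    refine congrArg y (Fin.ext ?_)
    change ((b : ℕ) - 1) * n + i' = i' + n * (b - 1)
    ring
  · rfl

/-- The noise blocks for which the scheme may fail. -/
def badNoise (M : Matrix (Fin (max k₁ k₂)) (Fin n) (ZMod 2) ×
      Matrix (Fin (max k₁ k₂)) (Fin n) (ZMod 2))
    (T₁ T₂ T₃ : Finset (Fin n → ZMod 2)) : Set (Blocks ((m + 1) * n)) :=
  ⋃ b : Fin (m + 1),
    ({z | z.1 ∈ {x | blockOf x b ∈ confusable T₁ (padDiffs (max k₁ k₂) k₁ k₂) M}} ∪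
      {z | z.2.1 ∈ {x | blockOf x b ∈ confusable T₂ (padDiffs (max k₁ k₂) k₂ k₁) M}}) ∪
      {z | z.2.2 ∈ {x | blockOf x b ∈ confusable T₃ (leftDiffs (max k₁ k₂)) M}}

variable {M : Matrix (Fin (max k₁ k₂)) (Fin n) (ZMod 2) ×
    Matrix (Fin (max k₁ k₂)) (Fin n) (ZMod 2)} {T₁ T₂ T₃ : Finset (Fin n → ZMod 2)}

theorem notMem_badNoise {z : Blocks ((m + 1) * n)} (hz : z ∉ badNoise M T₁ T₂ T₃) :
    (∀ b, blockOf z.1 b ∉ confusable T₁ (padDiffs (max k₁ k₂) k₁ k₂) M) ∧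
      (∀ b, blockOf z.2.1 b ∉ confusable T₂ (padDiffs (max k₁ k₂) k₂ k₁) M) ∧
      ∀ b, blockOf z.2.2 b ∉ confusable T₃ (leftDiffs (max k₁ k₂)) M := by
  simp only [badNoise, Set.mem_iUnion, Set.mem_union, Set.mem_ofPred_eq, not_exists, not_or] at hz
  exact ⟨fun b => (hz b).1.1, fun b => (hz b).1.2, fun b => (hz b).2⟩

/-- Union bound over the blocks; within each of them the noise has the same law as a noise vector of
length `n`. -/
theorem weight_badNoise_le {ε₁ ε₂ ε₃ : ℝ} (h₁ : ε₁ ∈ Set.Icc (0 : ℝ) 1)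
    (h₂ : ε₂ ∈ Set.Icc (0 : ℝ) 1) (h₃ : ε₃ ∈ Set.Icc (0 : ℝ) 1) :
    weight (jointLaw ε₁ ε₂ ε₃) (badNoise (m := m) M T₁ T₂ T₃) ≤ (m + 1) *
      (weight (noiseLaw ε₁) (confusable T₁ (padDiffs (max k₁ k₂) k₁ k₂) M) +
        weight (noiseLaw ε₂) (confusable T₂ (padDiffs (max k₁ k₂) k₂ k₁) M) +
        weight (noiseLaw ε₃) (confusable T₃ (leftDiffs (max k₁ k₂)) M)) := by
  have hnn := jointLaw_nonneg (n := (m + 1) * n) h₁ h₂ h₃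
  have hinj : ∀ b : Fin (m + 1),
      Function.Injective fun i : Fin n => finProdFinEquiv (b, i) := fun b i j hij =>
    congrArg Prod.snd (finProdFinEquiv.injective hij)
  have hw : ∀ (ε : ℝ) (b : Fin (m + 1)) (S : Set (Fin n → ZMod 2)),
      weight (noiseLaw ε) {x | blockOf x b ∈ S} = weight (noiseLaw ε) S := fun ε b S =>
    weight_noiseLaw_comp (hinj b) S
  have hb : ∀ b : Fin (m + 1), weight (jointLaw ε₁ ε₂ ε₃)
      (({z : Blocks ((m + 1) * n) |
          z.1 ∈ {x | blockOf x b ∈ confusable T₁ (padDiffs (max k₁ k₂) k₁ k₂) M}} ∪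
        {z | z.2.1 ∈ {x | blockOf x b ∈ confusable T₂ (padDiffs (max k₁ k₂) k₂ k₁) M}}) ∪
        {z | z.2.2 ∈ {x | blockOf x b ∈ confusable T₃ (leftDiffs (max k₁ k₂)) M}}) ≤
      weight (noiseLaw ε₁) (confusable T₁ (padDiffs (max k₁ k₂) k₁ k₂) M) +
        weight (noiseLaw ε₂) (confusable T₂ (padDiffs (max k₁ k₂) k₂ k₁) M) +
        weight (noiseLaw ε₃) (confusable T₃ (leftDiffs (max k₁ k₂)) M) := fun b => by
    refine ((weight_union_le hnn _ _).trans
      (add_le_add_left (weight_union_le hnn _ _) _)).trans_eq ?_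
    rw [weight_jointLaw_fst, weight_jointLaw_snd, weight_jointLaw_trd, hw, hw, hw]
  refine ((weight_iUnion_le hnn _).trans (Finset.sum_le_sum fun b _ => hb b)).trans_eq ?_
  rw [Finset.sum_const, Finset.card_univ, Fintype.card_fin, nsmul_eq_mul]
  push_cast
  rfl

/-- No probability remains here: outside the bad set the relay finds every sum, so each receiver's
output is exactly the `signal` of the true messages plus noise that is not confusable. -/
theorem linearScheme_correct (w : (Fin m → Fin k₁ → ZMod 2) × (Fin m → Fin k₂ → ZMod 2) × Unit)
    {z : Blocks ((m + 1) * n)} (hz : z ∉ badNoise M T₁ T₂ T₃) :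
    ((linearScheme m M T₁ T₂ T₃).toCode.h₁
        (received (linearScheme m M T₁ T₂ T₃).toCode w z).1 = w ∧
      (linearScheme m M T₁ T₂ T₃).toCode.h₂
        (received (linearScheme m M T₁ T₂ T₃).toCode w z).2.1 = w) ∧
    ∀ b : Fin m, (linearScheme m M T₁ T₂ T₃).dec
        (blockOf (received (linearScheme m M T₁ T₂ T₃).toCode w z).2.2 b.castSucc) =
      pad (max k₁ k₂) (w.1 b) + pad (max k₁ k₂) (w.2.1 b) := by
  obtain ⟨u₁, u₂, ⟨⟩⟩ := w
  obtain ⟨hz₁, hz₂, hz₃⟩ := notMem_badNoise hz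
  set s := linearScheme m M T₁ T₂ T₃ with hs
  set y₃ := encodeBlocks M.1 u₁ + encodeBlocks M.1 u₂ + z.2.2 with hy₃
  have hb₃ : ∀ b : Fin (m + 1), s.dec (blockOf y₃ b) =
      pad (max k₁ k₂) (blockAt u₁ b) + pad (max k₁ k₂) (blockAt u₂ b) := fun b => by
    -- The common generator matrix makes the sum of the two codewords the codeword of the sum.
    have : blockOf y₃ b = (pad (max k₁ k₂) (blockAt u₁ b) + pad (max k₁ k₂) (blockAt u₂ b)) ᵥ* M.1
        + blockOf z.2.2 b := by
      rw [Matrix.add_vecMul, ← blockOf_encodeBlocks, ← blockOf_encodeBlocks]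
      rfl
    rw [this]
    exact sumDecoder_eq (hz₃ b) _
  have hrel : ∀ b : Fin (m + 1), blockOf (relayInput s.toCode () y₃) b =
      (pad (max k₁ k₂) (prevAt u₁ b) + pad (max k₁ k₂) (prevAt u₂ b)) ᵥ* M.2 := fun b => by
    rw [blockOf_relayInput]
    split_ifs with hb
    · rw [hb₃, prevAt, prevAt, if_neg (by omega), if_neg (by omega)]
      rfl
    · rw [prevAt, prevAt, if_pos (by omega), if_pos (by omega), pad_zero, pad_zero, add_zero,
        Matrix.zero_vecMul]
  refine ⟨⟨?_, ?_⟩, fun b => ?_⟩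
  · have : jointDecoder m k₁ k₂ M T₁ (received s.toCode (u₁, u₂, ()) z).1 = (u₁, u₂) := by
      refine jointDecoder_eq hz₁ fun b => ?_
      rw [signal, ← hrel, ← blockOf_encodeBlocks]
      rfl
    exact congrArg (fun p : (Fin m → Fin k₁ → ZMod 2) × (Fin m → Fin k₂ → ZMod 2) =>
      (p.1, p.2, ())) this
  · have : jointDecoder m k₂ k₁ M T₂ (received s.toCode (u₁, u₂, ()) z).2.1 = (u₂, u₁) := by
      refine jointDecoder_eq hz₂ fun b => ?_
      rw [signal, add_comm (pad (max k₁ k₂) (prevAt u₂ b)), ← hrel, ← blockOf_encodeBlocks]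
      rfl
    exact congrArg (fun p : (Fin m → Fin k₂ → ZMod 2) × (Fin m → Fin k₁ → ZMod 2) =>
      (p.2, p.1, ())) this
  · refine (hb₃ b.castSucc).trans ?_
    simp [blockAt]

end Blocks

/-- With `2 ^ (n * (Hb ε + δ))` typical vectors at most, the second term is at most `2 ^ (r + 2) * 2
^ (-δ * n)`. One `δ` of the gap pays for typicality, the other gives the decay. -/
theorem tendsto_linearBound {ε : ℝ} (h : ε ∈ Set.Icc (0 : ℝ) 1) {δ r : ℝ} (hδ : 0 < δ)
    (hr : r + 2 * δ ≤ 1 - Hb ε) {k : ℕ → ℕ} (hk : ∀ n : ℕ, (k n : ℝ) ≤ (n + 1) * r + 2) :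
    Tendsto (fun n => linearBound ε δ n (k n)) atTop (𝓝 0) := by
  have hexp : Tendsto (fun n : ℕ => (2 : ℝ) ^ (r + 2) * ((2 : ℝ) ^ (-δ)) ^ n) atTop
      (𝓝 ((2 : ℝ) ^ (r + 2) * 0)) := by
    refine (tendsto_pow_atTop_nhds_zero_of_lt_one (by positivity) ?_).const_mul _
    exact Real.rpow_lt_one_of_one_lt_of_neg (by norm_num) (by linarith)
  have h2 : Tendsto (fun n : ℕ => (2 : ℝ) ^ k n * (typical ε δ n).card / 2 ^ n) atTop (𝓝 0) := by
    rw [mul_zero] at hexp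
    refine squeeze_zero (fun n => by positivity) (fun n => ?_) hexp
    rw [div_le_iff₀ (by positivity)]
    refine (mul_le_mul_of_nonneg_left (card_typical_le h δ n) (by positivity)).trans ?_
    rw [← Real.rpow_natCast 2 (k n), ← Real.rpow_natCast 2 n, ← Real.rpow_natCast _ n,
      ← Real.rpow_mul (by norm_num), ← Real.rpow_add (by norm_num), ← Real.rpow_add (by norm_num),
      ← Real.rpow_add (by norm_num)]
    refine Real.rpow_le_rpow_of_exponent_le (by norm_num) ?_
    have h3 : (0 : ℝ) ≤ n := Nat.cast_nonneg n
    nlinarith [hk n, mul_le_mul_of_nonneg_left hr h3]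
  simpa [linearBound] using (tendsto_weight_typical_compl h hδ).add h2

/-! ### The direct part -/

section Direct

/-- The direct part: for rates in the interior of the region there are linear schemes for which
the error probabilities vanish uniformly in the messages. -/
theorem exists_linearSchemes {ε₁ ε₂ ε₃ : ℝ} (h₁ : ε₁ ∈ Set.Icc (0 : ℝ) 1)
    (h₂ : ε₂ ∈ Set.Icc (0 : ℝ) 1) (h₃ : ε₃ ∈ Set.Icc (0 : ℝ) 1) {R₁ R₂ : ℝ}
    (hR₁ : 0 ≤ R₁) (hR₂ : 0 ≤ R₂) (h₁₃ : R₁ < 1 - Hb ε₃) (h₂₃ : R₂ < 1 - Hb ε₃)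
    (hs₁ : R₁ + R₂ < 1 - Hb ε₁) (hs₂ : R₁ + R₂ < 1 - Hb ε₂) :
    ∃ (m : ℕ) (k₁ k₂ : ℕ → ℕ) (s : (n : ℕ) → LinearScheme m n (k₁ n) (k₂ n)) (η : ℕ → ℝ)
      (B : (n : ℕ) → Set (Blocks ((m + 1) * n))),
      (∀ n : ℕ, ((m : ℝ) + 1) * (n + 1) * R₁ ≤ (m : ℝ) * k₁ n) ∧
      (∀ n : ℕ, ((m : ℝ) + 1) * (n + 1) * R₂ ≤ (m : ℝ) * k₂ n) ∧
      Tendsto η atTop (𝓝 0) ∧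
      (∀ n, weight (jointLaw ε₁ ε₂ ε₃) (B n) ≤ η n) ∧
      ∀ n w z, z ∉ B n →
        ((s n).toCode.h₁ (received (s n).toCode w z).1 = w ∧
          (s n).toCode.h₂ (received (s n).toCode w z).2.1 = w) ∧
        ∀ b : Fin m, (s n).dec (blockOf (received (s n).toCode w z).2.2 b.castSucc) =
          pad (max (k₁ n) (k₂ n)) (w.1 b) + pad (max (k₁ n) (k₂ n)) (w.2.1 b) := by
  have hq : Tendsto (fun m : ℕ => 1 + 1 / (m : ℝ)) atTop (𝓝 (1 + 0)) :=
    tendsto_one_div_atTop_nhds_zero_nat.const_add 1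
  -- Only `m` of the `m + 1` blocks carry new bits, so the rate per message block is `(1 + 1 / m) *
  -- R`. Strict inequalities survive this factor for large `m`.
  have hlim : ∀ {R C : ℝ}, R < C → ∀ᶠ m : ℕ in atTop, (1 + 1 / (m : ℝ)) * R < C := fun {R C} h =>
    (hq.mul_const R).eventually_lt_const (by simpa using h)
  obtain ⟨m, hm, hm₁, hm₂, hm₃, hm₄⟩ := ((eventually_gt_atTop 0).and ((hlim h₁₃).and
    ((hlim h₂₃).and ((hlim hs₁).and (hlim hs₂))))).exists
  have hm' : (0 : ℝ) < m := by exact_mod_cast hm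
  set q : ℝ := 1 + 1 / (m : ℝ) with hqdef
  have hq0 : 0 < q := by positivity
  have hmq : (m : ℝ) * q = m + 1 := by
    rw [hqdef]
    field_simp
  obtain ⟨δ, hδ, hd⟩ : ∃ δ > 0, max (q * R₁) (q * R₂) + 2 * δ ≤ 1 - Hb ε₃ ∧
      q * (R₁ + R₂) + 2 * δ ≤ 1 - Hb ε₁ ∧ q * (R₁ + R₂) + 2 * δ ≤ 1 - Hb ε₂ := by
    have hmax : max (q * R₁) (q * R₂) < 1 - Hb ε₃ := max_lt hm₁ hm₂
    refine ⟨min (1 - Hb ε₃ - max (q * R₁) (q * R₂))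
      (min (1 - Hb ε₁ - q * (R₁ + R₂)) (1 - Hb ε₂ - q * (R₁ + R₂))) / 2, ?_, ?_, ?_, ?_⟩
    · refine half_pos (lt_min ?_ (lt_min ?_ ?_)) <;> linarith
    · linarith [min_le_left (1 - Hb ε₃ - max (q * R₁) (q * R₂))
        (min (1 - Hb ε₁ - q * (R₁ + R₂)) (1 - Hb ε₂ - q * (R₁ + R₂)))]
    · linarith [(min_le_right (1 - Hb ε₃ - max (q * R₁) (q * R₂)) _).trans
        (min_le_left (1 - Hb ε₁ - q * (R₁ + R₂)) (1 - Hb ε₂ - q * (R₁ + R₂)))]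
    · linarith [(min_le_right (1 - Hb ε₃ - max (q * R₁) (q * R₂)) _).trans
        (min_le_right (1 - Hb ε₁ - q * (R₁ + R₂)) (1 - Hb ε₂ - q * (R₁ + R₂)))]
  -- The factor `n + 1` instead of `n` provides enough bits for all code lengths below `(m + 1) * (n
  -- + 1)`, including those not divisible by `m + 1`.
  let k : ℝ → ℕ → ℕ := fun R n => ⌈(n + 1) * (q * R)⌉₊
  have hk : ∀ (R : ℝ) (n : ℕ), ((m : ℝ) + 1) * (n + 1) * R ≤ m * k R n := fun R n => by
    calc ((m : ℝ) + 1) * (n + 1) * R = m * ((n + 1) * (q * R)) := by rw [← hmq]; ring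
      _ ≤ m * k R n := mul_le_mul_of_nonneg_left (Nat.le_ceil _) hm'.le
  have hk' : ∀ {R : ℝ}, 0 ≤ R → ∀ n : ℕ, (k R n : ℝ) ≤ (n + 1) * (q * R) + 1 := fun {R} hR n =>
    (Nat.ceil_lt_add_one (by positivity)).le
  have hksum : ∀ n : ℕ, ((k R₁ n + k R₂ n : ℕ) : ℝ) ≤ (n + 1) * (q * (R₁ + R₂)) + 2 := fun n => by
    push_cast
    linarith [hk' hR₁ n, hk' hR₂ n]
  have hkmax : ∀ n : ℕ, ((max (k R₁ n) (k R₂ n) : ℕ) : ℝ) ≤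
      (n + 1) * max (q * R₁) (q * R₂) + 2 := fun n => by
    have hn : (0 : ℝ) ≤ n + 1 := by positivity
    rw [Nat.cast_max]
    refine max_le ?_ ?_
    · linarith [hk' hR₁ n, mul_le_mul_of_nonneg_left (le_max_left (q * R₁) (q * R₂)) hn]
    · linarith [hk' hR₂ n, mul_le_mul_of_nonneg_left (le_max_right (q * R₁) (q * R₂)) hn]
  choose M hM using fun n => exists_matrices h₁ h₂ h₃ δ n
    (le_max_left (k R₁ n) (k R₂ n)) (le_max_right (k R₁ n) (k R₂ n))
  refine ⟨m, k R₁, k R₂,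
    fun n => linearScheme m (M n) (typical ε₁ δ n) (typical ε₂ δ n) (typical ε₃ δ n),
    fun n => (m + 1) * (linearBound ε₁ δ n (k R₁ n + k R₂ n) +
      linearBound ε₂ δ n (k R₁ n + k R₂ n) + linearBound ε₃ δ n (max (k R₁ n) (k R₂ n))),
    fun n => badNoise (M n) (typical ε₁ δ n) (typical ε₂ δ n) (typical ε₃ δ n), hk R₁, hk R₂,
    ?_, fun n => ?_, fun n w z hz => linearScheme_correct w hz⟩
  · have := (((tendsto_linearBound h₁ hδ hd.2.1 hksum).add
      (tendsto_linearBound h₂ hδ hd.2.2 hksum)).add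
      (tendsto_linearBound h₃ hδ hd.1 hkmax)).const_mul ((m : ℝ) + 1)
    simpa using this
  · exact (weight_badNoise_le h₁ h₂ h₃).trans
      (mul_le_mul_of_nonneg_left (hM n) (by positivity))

variable {ε₁ ε₂ ε₃ : ℝ} (h₁ : ε₁ ∈ Set.Icc (0 : ℝ) 1) (h₂ : ε₂ ∈ Set.Icc (0 : ℝ) 1)
  (h₃ : ε₃ ∈ Set.Icc (0 : ℝ) 1)

theorem linearAchievable_of_lt {R₁ R₂ : ℝ} (hR₁ : 0 ≤ R₁) (hR₂ : 0 ≤ R₂) (h₁₃ : R₁ < 1 - Hb ε₃)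
    (h₂₃ : R₂ < 1 - Hb ε₃) (hs₁ : R₁ + R₂ < 1 - Hb ε₁) (hs₂ : R₁ + R₂ < 1 - Hb ε₂) :
    LinearAchievable (bsChannel ε₁ ε₂ ε₃ h₁ h₂ h₃) R₁ R₂ := by
  obtain ⟨m, k₁, k₂, s, η, B, hk₁, hk₂, hη, hB, hcor⟩ :=
    exists_linearSchemes h₁ h₂ h₃ hR₁ hR₂ h₁₃ h₂₃ hs₁ hs₂
  have hnn := fun n => jointLaw_nonneg (n := n) h₁ h₂ h₃
  have hη0 : ∀ n, 0 ≤ η n := fun n => (weight_nonneg (hnn _) _).trans (hB n)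
  refine ⟨hR₁, hR₂, m, k₁, k₂, s, fun n => le_trans ?_ (hk₁ n), fun n => le_trans ?_ (hk₂ n),
    squeeze_zero (fun n => avgProb_nonneg h₁ h₂ h₃ _ _) (fun n => ?_) hη,
    squeeze_zero (fun n => avgProb_nonneg h₁ h₂ h₃ _ _) (fun n => ?_) hη⟩
  · gcongr
    linarith
  · gcongr
    linarith
  · refine avgProb_le h₁ h₂ h₃ _ (hη0 n) fun w => (weight_mono (hnn _) fun z hz => ?_).trans (hB n)
    by_contra hz'
    have := (hcor n w z hz').1
    exact hz.elim (fun h => h this.1) fun h => h this.2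
  · refine avgProb_le h₁ h₂ h₃ _ (hη0 n) fun w => (weight_mono (hnn _) fun z hz => ?_).trans (hB n)
    by_contra hz'
    obtain ⟨b, hb⟩ := hz
    exact hb ((hcor n w z hz').2 b)

end Direct

/-! ### Codes of arbitrary length -/

section Extend

variable {V₁ V₂ V₃ W₁ W₂ W₃ : Type} {n N : ℕ}

/-- The code of length `N` that uses a code of length `n ≤ N` at the first `n` times, with the
messages mapped to those of the given code by `a₁`, `a₂`, `a₃`, and back by `d₁`, `d₂`, `d₃`. -/
def Code.extend (c : Code (ZMod 2) (ZMod 2) (ZMod 2) (ZMod 2) (ZMod 2) (ZMod 2) V₁ V₂ V₃ n)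
    (hn : n ≤ N) (a₁ : W₁ → V₁) (a₂ : W₂ → V₂) (a₃ : W₃ → V₃) (d₁ : V₁ → W₁) (d₂ : V₂ → W₂)
    (d₃ : V₃ → W₃) :
    Code (ZMod 2) (ZMod 2) (ZMod 2) (ZMod 2) (ZMod 2) (ZMod 2) W₁ W₂ W₃ N where
  f₁ w j := if h : (j : ℕ) < n then c.f₁ (a₁ w) ⟨j, h⟩ else 0
  f₂ w j := if h : (j : ℕ) < n then c.f₂ (a₂ w) ⟨j, h⟩ else 0
  g j w y := if h : (j : ℕ) < n then c.g ⟨j, h⟩ (a₃ w) y else 0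
  h₁ y := Prod.map d₁ (Prod.map d₂ d₃) (c.h₁ (y ∘ Fin.castLE hn))
  h₂ y := Prod.map d₁ (Prod.map d₂ d₃) (c.h₂ (y ∘ Fin.castLE hn))

/-- The restriction of three blocks to their first `n` times. -/
def Blocks.restrict (hn : n ≤ N) (z : Blocks N) : Blocks n :=
  (z.1 ∘ Fin.castLE hn, z.2.1 ∘ Fin.castLE hn, z.2.2 ∘ Fin.castLE hn)

theorem received_extend
    (c : Code (ZMod 2) (ZMod 2) (ZMod 2) (ZMod 2) (ZMod 2) (ZMod 2) V₁ V₂ V₃ n)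
    (hn : n ≤ N) (a₁ : W₁ → V₁) (a₂ : W₂ → V₂) (a₃ : W₃ → V₃) (d₁ : V₁ → W₁) (d₂ : V₂ → W₂)
    (d₃ : V₃ → W₃) (w : W₁ × W₂ × W₃) (z : Blocks N) :
    (received (c.extend hn a₁ a₂ a₃ d₁ d₂ d₃) w z).restrict hn =
      received c (a₁ w.1, a₂ w.2.1, a₃ w.2.2) (z.restrict hn) := by
  set c' := c.extend hn a₁ a₂ a₃ d₁ d₂ d₃ with hc'
  have hf₁ : ∀ j : Fin n, c'.f₁ w.1 (Fin.castLE hn j) = c.f₁ (a₁ w.1) j := fun j =>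
    dif_pos j.isLt
  have hf₂ : ∀ j : Fin n, c'.f₂ w.2.1 (Fin.castLE hn j) = c.f₂ (a₂ w.2.1) j := fun j =>
    dif_pos j.isLt
  have hy : (c'.f₁ w.1 + c'.f₂ w.2.1 + z.2.2) ∘ Fin.castLE hn =
      c.f₁ (a₁ w.1) + c.f₂ (a₂ w.2.1) + z.2.2 ∘ Fin.castLE hn := by
    funext j
    simp only [Function.comp_apply, Pi.add_apply, hf₁, hf₂]
  have hg : ∀ (y : Fin N → ZMod 2) (j : Fin n),
      relayInput c' w.2.2 y (Fin.castLE hn j) =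
        relayInput c (a₃ w.2.2) (y ∘ Fin.castLE hn) j := fun y j =>
    dif_pos j.isLt
  refine Prod.ext ?_ (Prod.ext ?_ hy)
  · funext j
    simp only [Blocks.restrict, received, Function.comp_apply, Pi.add_apply, hf₁, hg, hy]
  · funext j
    simp only [Blocks.restrict, received, Function.comp_apply, Pi.add_apply, hf₂, hg, hy]

theorem weight_jointLaw_restrict (hn : n ≤ N) (ε₁ ε₂ ε₃ : ℝ) (S : Set (Blocks n)) :
    weight (jointLaw ε₁ ε₂ ε₃) {z : Blocks N | z.restrict hn ∈ S} =
      weight (jointLaw ε₁ ε₂ ε₃) S := by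
  have he : Function.Injective (Fin.castLE hn) := Fin.castLE_injective hn
  rw [weight_jointLaw_eq₁, weight_jointLaw_eq₁]
  have h1 : ∀ z₂ z₃ : Fin N → ZMod 2, weight (noiseLaw ε₁)
      {z₁ | (z₁, z₂, z₃) ∈ {z : Blocks N | z.restrict hn ∈ S}} =
        weight (noiseLaw ε₁) {z₁ | (z₁, z₂ ∘ Fin.castLE hn, z₃ ∘ Fin.castLE hn) ∈ S} :=
    fun z₂ z₃ => weight_noiseLaw_comp he
      {z₁ | (z₁, z₂ ∘ Fin.castLE hn, z₃ ∘ Fin.castLE hn) ∈ S}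
  simp only [h1, mul_assoc, ← Finset.mul_sum]
  have h2 : ∀ z₂ : Fin n → ZMod 2, ∑ z₃ : Fin N → ZMod 2, noiseLaw ε₃ z₃ *
      weight (noiseLaw ε₁) {z₁ | (z₁, z₂, z₃ ∘ Fin.castLE hn) ∈ S} =
        ∑ z₃, noiseLaw ε₃ z₃ * weight (noiseLaw ε₁) {z₁ | (z₁, z₂, z₃) ∈ S} := fun z₂ =>
    sum_noiseLaw_mul_comp he fun z₃ => weight (noiseLaw ε₁) {z₁ | (z₁, z₂, z₃) ∈ S}
  simp only [h2]
  exact sum_noiseLaw_mul_comp he fun z₂ => ∑ z₃, noiseLaw ε₃ z₃ *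
    weight (noiseLaw ε₁) {z₁ | (z₁, z₂, z₃) ∈ S}

end Extend

/-! ### Achievability and closure -/

section Capacity

variable {ε₁ ε₂ ε₃ : ℝ} (h₁ : ε₁ ∈ Set.Icc (0 : ℝ) 1) (h₂ : ε₂ ∈ Set.Icc (0 : ℝ) 1)
  (h₃ : ε₃ ∈ Set.Icc (0 : ℝ) 1)

theorem exists_embedding {m k : ℕ} {x : ℝ} (hx : x ≤ m * k) :
    ∃ a : Fin ⌊(2 : ℝ) ^ x⌋₊ → Fin m → Fin k → ZMod 2, Function.Injective a := by
  have hcard : Fintype.card (Fin ⌊(2 : ℝ) ^ x⌋₊) ≤ Fintype.card (Fin m → Fin k → ZMod 2) := by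
    simp only [Fintype.card_pi, Finset.prod_const, Finset.card_univ, Fintype.card_fin, ZMod.card]
    refine Nat.floor_le_of_le ?_
    rw [← pow_mul]
    push_cast
    rw [← Real.rpow_natCast]
    refine Real.rpow_le_rpow_of_exponent_le (by norm_num) ?_
    push_cast
    linarith
  obtain ⟨a⟩ := Function.Embedding.nonempty_of_card_le hcard
  exact ⟨a, a.injective⟩

/-- A linear scheme with block length `N / (m + 1)` is run at the first times and the rest stays
idle. The bad noise set is the same for all messages, so any injection of the message sets into the
bit vectors preserves the error bound. -/
theorem achievable_of_lt {R₁ R₂ : ℝ} (hR₁ : 0 ≤ R₁) (hR₂ : 0 ≤ R₂) (h₁₃ : R₁ < 1 - Hb ε₃)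
    (h₂₃ : R₂ < 1 - Hb ε₃) (hs₁ : R₁ + R₂ < 1 - Hb ε₁) (hs₂ : R₁ + R₂ < 1 - Hb ε₂) :
    Achievable (bsChannel ε₁ ε₂ ε₃ h₁ h₂ h₃) R₁ R₂ 0 := by
  obtain ⟨m, k₁, k₂, s, η, B, hk₁, hk₂, hη, hB, hcor⟩ :=
    exists_linearSchemes h₁ h₂ h₃ hR₁ hR₂ h₁₃ h₂₃ hs₁ hs₂
  have hnn := fun n => jointLaw_nonneg (n := n) h₁ h₂ h₃
  have hη0 : ∀ n, 0 ≤ η n := fun n => (weight_nonneg (hnn _) _).trans (hB n)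
  have hdiv : ∀ N : ℕ, (m + 1) * (N / (m + 1)) ≤ N := fun N => Nat.mul_div_le N (m + 1)
  have hlt : ∀ N : ℕ, (N : ℝ) ≤ ((m : ℝ) + 1) * ((N / (m + 1) : ℕ) + 1) := fun N => by
    exact_mod_cast (Nat.lt_mul_div_succ N (Nat.succ_pos m)).le
  have hpos : ∀ {R : ℝ}, 0 ≤ R → ∀ N : ℕ, Nonempty (Fin ⌊(2 : ℝ) ^ ((N : ℝ) * R)⌋₊) :=
    fun {R} hR N => by
      have h : (1 : ℝ) ≤ 2 ^ ((N : ℝ) * R) := Real.one_le_rpow (by norm_num) (by positivity)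
      exact ⟨⟨0, Nat.floor_pos.2 h⟩⟩
  have hsub : ∀ N : ℕ, Subsingleton (Fin ⌊(2 : ℝ) ^ ((N : ℝ) * 0)⌋₊) := fun N => by
    rw [mul_zero, Real.rpow_zero, Nat.floor_one]
    infer_instance
  choose a₁ ha₁ using fun N : ℕ => exists_embedding (x := N * R₁)
    ((mul_le_mul_of_nonneg_right (hlt N) hR₁).trans (hk₁ (N / (m + 1))))
  choose a₂ ha₂ using fun N : ℕ => exists_embedding (x := N * R₂)
    ((mul_le_mul_of_nonneg_right (hlt N) hR₂).trans (hk₂ (N / (m + 1))))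
  have i₁ := hpos hR₁
  have i₂ := hpos hR₂
  have i₃ := hpos le_rfl
  refine ⟨hR₁, hR₂, le_rfl, fun N => (s (N / (m + 1))).toCode.extend (hdiv N) (a₁ N) (a₂ N)
    (fun _ => ()) (Function.invFun (a₁ N)) (Function.invFun (a₂ N))
    (fun _ => Classical.choice (i₃ N)), ?_⟩
  have hN : Tendsto (fun N : ℕ => N / (m + 1)) atTop atTop :=
    Nat.tendsto_div_const_atTop (Nat.succ_ne_zero m)
  refine squeeze_zero (fun N => avgProb_nonneg h₁ h₂ h₃ _ _) (fun N => ?_) (hη.comp hN)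
  refine avgProb_le h₁ h₂ h₃ _ (hη0 _) fun w => ?_
  refine le_trans (weight_mono (hnn _) fun z hz => ?_)
    ((weight_jointLaw_restrict (hdiv N) ε₁ ε₂ ε₃ (B (N / (m + 1)))).trans_le (hB _))
  by_contra hz'
  have hrec := received_extend (s (N / (m + 1))).toCode (hdiv N) (a₁ N) (a₂ N)
    (fun _ => ()) (Function.invFun (a₁ N)) (Function.invFun (a₂ N))
    (fun _ => Classical.choice (i₃ N)) w z
  have hc := (hcor _ (a₁ N w.1, a₂ N w.2.1, ()) _ hz').1
  rw [← hrec] at hc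
  have hback : Prod.map (Function.invFun (a₁ N)) (Prod.map (Function.invFun (a₂ N))
      (fun _ => Classical.choice (i₃ N))) (a₁ N w.1, a₂ N w.2.1, ()) = w :=
    Prod.ext (Function.leftInverse_invFun (ha₁ N) w.1)
      (Prod.ext (Function.leftInverse_invFun (ha₂ N) w.2.1) ((hsub N).elim _ _))
  exact hz.elim (fun h => h ((congrArg _ hc.1).trans hback))
    fun h => h ((congrArg _ hc.2).trans hback)

/-- The origin needs its own scheme: if some channel has capacity zero, no pair satisfies the strict
inequalities. With `m = 0` there is only one message and nothing can go wrong. -/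
theorem linearAchievable_zero : LinearAchievable (bsChannel ε₁ ε₂ ε₃ h₁ h₂ h₃) 0 0 := by
  refine ⟨le_rfl, le_rfl, 0, fun _ => 0, fun _ => 0, fun n => ⟨0, 0, 0, 0, 0⟩, by simp, by simp,
    squeeze_zero (fun n => avgProb_nonneg h₁ h₂ h₃ _ _) (fun n => ?_) tendsto_const_nhds,
    squeeze_zero (fun n => avgProb_nonneg h₁ h₂ h₃ _ _) (fun n => ?_) tendsto_const_nhds⟩
  · refine avgProb_le h₁ h₂ h₃ _ le_rfl fun w => le_of_eq ?_
    refine Finset.sum_eq_zero fun z _ => Set.indicator_of_notMem ?_ _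
    exact fun hz => hz.elim (fun h => h (Subsingleton.elim _ _)) fun h => h (Subsingleton.elim _ _)
  · refine avgProb_le h₁ h₂ h₃ _ le_rfl fun w => le_of_eq ?_
    refine Finset.sum_eq_zero fun z _ => Set.indicator_of_notMem ?_ _
    rintro ⟨b, -⟩
    exact b.elim0

theorem achievable_zero : Achievable (bsChannel ε₁ ε₂ ε₃ h₁ h₂ h₃) 0 0 0 := by
  have hsub : ∀ N : ℕ, Subsingleton (Fin ⌊(2 : ℝ) ^ ((N : ℝ) * 0)⌋₊) := fun N => by
    rw [mul_zero, Real.rpow_zero, Nat.floor_one]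
    infer_instance
  let o : ∀ N : ℕ, Fin ⌊(2 : ℝ) ^ ((N : ℝ) * 0)⌋₊ := fun N => ⟨0, by simp⟩
  refine ⟨le_rfl, le_rfl, le_rfl, fun N => ⟨0, 0, 0, fun _ => (o N, o N, o N),
    fun _ => (o N, o N, o N)⟩,
    squeeze_zero (fun n => avgProb_nonneg h₁ h₂ h₃ _ _) (fun n => ?_) tendsto_const_nhds⟩
  refine avgProb_le h₁ h₂ h₃ _ le_rfl fun w => le_of_eq ?_
  refine Finset.sum_eq_zero fun z _ => Set.indicator_of_notMem ?_ _
  exact fun hz => hz.elim (fun h => h (Subsingleton.elim _ _)) fun h => h (Subsingleton.elim _ _)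

/-- A nonzero point of the region forces all three capacities to be positive, so scaling it by a
factor below one makes every upper bound strict. -/
theorem rateRegion_subset_closure {A : ℝ → ℝ → Prop} (h0 : A 0 0)
    (hA : ∀ {R₁ R₂ : ℝ}, 0 ≤ R₁ → 0 ≤ R₂ → R₁ < 1 - Hb ε₃ → R₂ < 1 - Hb ε₃ →
      R₁ + R₂ < 1 - Hb ε₁ → R₁ + R₂ < 1 - Hb ε₂ → A R₁ R₂) :
    rateRegion ε₁ ε₂ ε₃ ⊆ closure {R : ℝ × ℝ | A R.1 R.2} := by
  rintro ⟨R₁, R₂⟩ ⟨hR₁, hR₂, h₁₃, h₂₃, hs⟩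
  dsimp only at hR₁ hR₂ h₁₃ h₂₃ hs
  have hs₁ := hs.trans (min_le_left _ _)
  have hs₂ := hs.trans (min_le_right _ _)
  by_cases hz : R₁ = 0 ∧ R₂ = 0
  · rw [hz.1, hz.2]
    exact subset_closure h0
  have hsum : 0 < R₁ + R₂ := by
    refine lt_of_le_of_ne (by linarith) fun h => hz ⟨?_, ?_⟩ <;> linarith
  have hC : 0 < 1 - Hb ε₃ := by
    by_contra! h
    linarith
  have hlim : Tendsto (fun n : ℕ => ((1 - 1 / ((n : ℝ) + 1)) * R₁, (1 - 1 / ((n : ℝ) + 1)) * R₂))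
      atTop (𝓝 (R₁, R₂)) := by
    have h : Tendsto (fun n : ℕ => 1 - 1 / ((n : ℝ) + 1)) atTop (𝓝 1) := by
      simpa using (tendsto_one_div_add_atTop_nhds_zero_nat (𝕜 := ℝ)).const_sub 1
    have := (h.mul_const R₁).prodMk_nhds (h.mul_const R₂)
    simpa only [one_mul] using this
  refine mem_closure_of_tendsto hlim (Eventually.of_forall fun n => ?_)
  have hn : (0 : ℝ) < 1 / ((n : ℝ) + 1) := by positivity
  have hn1 : 1 / ((n : ℝ) + 1) ≤ 1 := by
    rw [div_le_one (by positivity)]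
    linarith [Nat.cast_nonneg (α := ℝ) n]
  set t := 1 - 1 / ((n : ℝ) + 1) with ht
  have ht0 : 0 ≤ t := by linarith
  have ht1 : t < 1 := by linarith
  have hlt : ∀ {x C : ℝ}, x ≤ C → 0 < C → t * x < C := fun {x C} hx hC' => by
    nlinarith [mul_le_mul_of_nonneg_left hx ht0]
  refine hA (by positivity) (by positivity) (hlt h₁₃ hC) (hlt h₂₃ hC) ?_ ?_
  · rw [← mul_add]
    exact hlt hs₁ (by linarith)
  · rw [← mul_add]
    exact hlt hs₂ (by linarith)

end Capacity

end CMACr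

theorem proposition7 (ε₁ ε₂ ε₃ : ℝ) (h₁ : ε₁ ∈ Set.Icc (0 : ℝ) 1)
    (h₂ : ε₂ ∈ Set.Icc (0 : ℝ) 1) (h₃ : ε₃ ∈ Set.Icc (0 : ℝ) 1) :
    CMACr.capacityRegion (CMACr.bsChannel ε₁ ε₂ ε₃ h₁ h₂ h₃) =
        {R : ℝ × ℝ | 0 ≤ R.1 ∧ 0 ≤ R.2 ∧
          R.1 ≤ 1 - CMACr.Hb ε₃ ∧ R.2 ≤ 1 - CMACr.Hb ε₃ ∧
          R.1 + R.2 ≤ min (1 - CMACr.Hb ε₁) (1 - CMACr.Hb ε₂)} ∧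
      closure {R : ℝ × ℝ | CMACr.LinearAchievable
          (CMACr.bsChannel ε₁ ε₂ ε₃ h₁ h₂ h₃) R.1 R.2} =
        CMACr.capacityRegion (CMACr.bsChannel ε₁ ε₂ ε₃ h₁ h₂ h₃) := by
  have hcap : CMACr.capacityRegion (CMACr.bsChannel ε₁ ε₂ ε₃ h₁ h₂ h₃) =
      CMACr.rateRegion ε₁ ε₂ ε₃ :=
    Set.Subset.antisymm
      (closure_minimal (fun _ => CMACr.mem_rateRegion_of_achievable h₁ h₂ h₃)
        (CMACr.isClosed_rateRegion ε₁ ε₂ ε₃))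
      (CMACr.rateRegion_subset_closure (A := fun R₁ R₂ => CMACr.Achievable _ R₁ R₂ 0)
        (CMACr.achievable_zero h₁ h₂ h₃) (CMACr.achievable_of_lt h₁ h₂ h₃))
  refine ⟨hcap, hcap.symm ▸ Set.Subset.antisymm
    (closure_minimal (fun _ => CMACr.mem_rateRegion_of_linearAchievable h₁ h₂ h₃)
      (CMACr.isClosed_rateRegion ε₁ ε₂ ε₃))
    (CMACr.rateRegion_subset_closure
      (CMACr.linearAchievable_zero h₁ h₂ h₃) (CMACr.linearAchievable_of_lt h₁ h₂ h₃))⟩
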